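/- Let $d\ge 2$ be an integer and $\alpha\in(0,d)$. For $F=(F_1,\dots,F_d)\in L^1(\mathbb{R}^d;\mathbb{R}^d)$ let $I_\alpha F=(I_\alpha F_1,\dots,I_\alpha F_d)$ be its Riesz potential, where $$I_\alpha f(x)=\frac1{\gamma(\alpha)}\int_{\mathbb{R}^d}\frac{f(y)}{|x-y|^{d-\alpha}}\,dy,\qquad \gamma(\alpha)=\frac{\pi^{d/2}2^{\alpha}\,\Gamma(\alpha/2)}{\Gamma((d-\alpha)/2)}.$$ For a measurable function $g:\mathbb{R}^d\to\mathbb{R}^d$ let $g^*(t)=\inf\{y\ge 0: |\{x : |g(x)|>y\}|<t\}$ $(t>0)$ be the left-continuous non-increasing rearrangement of its Euclidean norm, let $g^{**}(t)=\frac1t\int_0^t g^*(s)\,ds$, and for $1<q<\infty$ let $$\|g\|_{L^{q,1}(\mathbb{R}^d;\mathbb{R}^d)}=\int_0^\infty t^{1/q}g^{**}(t)\,\frac{dt}{t};$$ $L^{q,1}(\mathbb{R}^d;\mathbb{R}^d)$ is the space of measurable $g$ for which this is finite. Then there exists a constant $C=C(\alpha,d)>0$ such that for every $F\in L^1(\mathbb{R}^d;\mathbb{R}^d)$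 with $\operatorname{curl}F=0$ in the sense of distributions, that is, $\int_{\mathbb{R}^d} F_i\,\partial_j\varphi\,dx=\int_{\mathbb{R}^d} F_j\,\partial_i\varphi\,dx$ for all $i,j$ and all $\varphi\in C_c^\infty(\mathbb{R}^d)$, the integrals defining $I_\alpha F(x)$ converge absolutely for almost every $x$, $I_\alpha F\in L^{d/(d-\alpha),1}(\mathbb{R}^d;\mathbb{R}^d)$, and $$\|I_\alpha F\|_{L^{d/(d-\alpha),1}(\mathbb{R}^d;\mathbb{R}^d)}\le C\,\|F\|_{L^1(\mathbb{R}^d;\mathbb{R}^d)}.$$ -/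

import Mathlib

open MeasureTheory Set
open scoped ENNReal NNReal ContDiff

noncomputable section

/-- The normalization constant `γ(α) = π^{d/2} 2^α Γ(α/2) / Γ((d-α)/2)` of the Riesz potential
on `ℝ^d`. -/
def rieszConst (d : ℕ) (α : ℝ) : ℝ :=
  Real.pi ^ ((d : ℝ) / 2) * 2 ^ α * Real.Gamma (α / 2) / Real.Gamma (((d : ℝ) - α) / 2)

/-- The integrand `y ↦ f(y) / |x-y|^{d-α}` of the Riesz potential at the point `x`. -/
def rieszIntegrand {d : ℕ} (α : ℝ) (f : EuclideanSpace ℝ (Fin d) → ℝ)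
    (x y : EuclideanSpace ℝ (Fin d)) : ℝ :=
  f y / ‖x - y‖ ^ ((d : ℝ) - α)

/-- The Riesz potential `I_α f` of a scalar function. -/
def rieszPotential {d : ℕ} (α : ℝ) (f : EuclideanSpace ℝ (Fin d) → ℝ)
    (x : EuclideanSpace ℝ (Fin d)) : ℝ :=
  1 / rieszConst d α * ∫ y, rieszIntegrand α f x y

/-- The Riesz potential of a vector field, acting on components. -/
def rieszPotentialVec {d : ℕ} (α : ℝ)
    (F : EuclideanSpace ℝ (Fin d) → EuclideanSpace ℝ (Fin d))
    (x : EuclideanSpace ℝ (Fin d)) : EuclideanSpace ℝ (Fin d) :=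
  WithLp.toLp 2 fun i => rieszPotential α (fun y => F y i) x

/-- `curl F = 0` in the sense of distributions, that is, `∂_j F_i = ∂_i F_j` for all `i`, `j`,
tested against smooth compactly supported functions. -/
def CurlFree {d : ℕ} (F : EuclideanSpace ℝ (Fin d) → EuclideanSpace ℝ (Fin d)) : Prop :=
  ∀ i j : Fin d, ∀ φ : EuclideanSpace ℝ (Fin d) → ℝ, ContDiff ℝ ∞ φ → HasCompactSupport φ →
    ∫ x, F x i * fderiv ℝ φ x (EuclideanSpace.single j 1) =
      ∫ x, F x j * fderiv ℝ φ x (EuclideanSpace.single i 1)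

/-- The distribution function `m(f,y) = |{|f| > y}|`; for vector-valued `f`, `|f|` is its norm. -/
def distribFun {d : ℕ} {E : Type*} [NormedAddCommGroup E]
    (f : EuclideanSpace ℝ (Fin d) → E) (y : ℝ≥0) : ℝ≥0∞ :=
  volume {x | y < ‖f x‖₊}

/-- The non-increasing rearrangement `f^*`, the left-continuous inverse of `m(f,·)`:
`f^*(t) = inf {y ≥ 0 : m(f,y) < t}` for `t > 0` (`= ∞` if there is no such `y`). -/
def rearrangement {d : ℕ} {E : Type*} [NormedAddCommGroup E]
    (f : EuclideanSpace ℝ (Fin d) → E) (t : ℝ) : ℝ≥0∞ :=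
  ⨅ (y : ℝ≥0) (_ : distribFun f y < ENNReal.ofReal t), (y : ℝ≥0∞)

/-- `f^{**}(t) = (1/t) ∫_0^t f^*(s) ds` for `t > 0`. -/
def maximalRearrangement {d : ℕ} {E : Type*} [NormedAddCommGroup E]
    (f : EuclideanSpace ℝ (Fin d) → E) (t : ℝ) : ℝ≥0∞ :=
  (∫⁻ s in Ioc 0 t, rearrangement f s) / ENNReal.ofReal t

/-- The Lorentz norm `(∫_0^∞ (t^{1/q} f^{**}(t))^r dt/t)^{1/r}`, for `1 < q < ∞`, `1 ≤ r < ∞`. -/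
def lorentzNorm {d : ℕ} {E : Type*} [NormedAddCommGroup E] (q r : ℝ)
    (f : EuclideanSpace ℝ (Fin d) → E) : ℝ≥0∞ :=
  (∫⁻ t in Ioi (0 : ℝ),
    (ENNReal.ofReal (t ^ (1 / q)) * maximalRearrangement f t) ^ r / ENNReal.ofReal t) ^ (1 / r)

/-- Membership in the Lorentz space `L^{q,r}(ℝ^d; E)`. -/
def MemLorentz {d : ℕ} {E : Type*} [NormedAddCommGroup E] (q r : ℝ)
    (f : EuclideanSpace ℝ (Fin d) → E) : Prop :=
  AEStronglyMeasurable f volume ∧ lorentzNorm q r f < ⊤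

end

/-!
The Lorentz space `L^{q,1}` with `1/q = 1 - α/n` is the real interpolation space
`(L¹, L^∞)_{α/n,1}`, whose norm is countably subadditive and at most a multiple of
`‖g‖₁ ^ (1 - α/n) * ‖g‖_∞ ^ (α/n)`.

Suppose that `v` and `∇ v` obey the bounds `|v| ≤ N ρ ^ (1 - n)`, `‖v‖₁ ≤ N ρ` and `‖∇ v‖₁ ≤ N`
satisfied by a bump at scale `ρ`. Cutting the Riesz kernel into dyadic pieces `K_r`, the convolution
`K_r ⋆ ∇ v` can be estimated directly and as `∇ K_r ⋆ v`; the resulting bounds decay geometrically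
as `r / ρ` tends to `0` or to `∞`, and sum to a multiple of `N`. A general gradient `∇ u` is the sum
of the gradients of the parts of `u` of height comparable to `2 ^ j`. By the weak-type
Gagliardo–Nirenberg–Sobolev inequality each part obeys such bounds at a scale determined by `2 ^ j`
and by the mass of `∇ u` on the level sets at nearby heights, and these masses sum to a multiple of
`‖∇ u‖₁`.

A curl-free `F ∈ L¹` is an `L¹` limit of such gradients. If `Q` is a smooth field vanishing at
infinity whose divergence `P` has compact support, then `P ⋆ F = ∇ (∑ i, Q i ⋆ F i)`. Applied to the
rescalings of a truncated Newtonian field, for which the `P` form an approximate identity, this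
provides the approximations; a telescoping series of them represents `F`.
-/

open Filter Topology Module
open scoped Gradient Convolution

/-! ### Interpolation between `L¹` and `L^∞` -/

section Interpolation

variable {Ω G : Type*} [MeasurableSpace Ω] [NormedAddCommGroup G] {μ : Measure Ω} {θ : ℝ}

/-- The `K`-functional of the pair `(L¹, L^∞)`: the infimum of `‖g‖₁ + t ‖h‖_∞` over the
decompositions `f = g + h` that truncate `f` at some height `c`. -/
noncomputable def kFunctional (μ : Measure Ω) (f : Ω → G) (t : ℝ) : ℝ≥0∞ :=
  ⨅ c : ℝ≥0∞, ENNReal.ofReal t * c + ∫⁻ x, (‖f x‖ₑ - c) ∂μ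

/-- The norm of the real interpolation space `(L¹, L^∞)_{θ,1}`, which is the Lorentz space
`L^{q,1}` with `1/q = 1 - θ`. Unlike `lorentzNorm` it is visibly countably subadditive. -/
noncomputable def interpNorm (μ : Measure Ω) (θ : ℝ) (f : Ω → G) : ℝ≥0∞ :=
  ∫⁻ t in Ioi (0 : ℝ), ENNReal.ofReal (t ^ (-1 - θ)) * kFunctional μ f t

theorem kFunctional_le_add (f : Ω → G) (t : ℝ) (c : ℝ≥0∞) :
    kFunctional μ f t ≤ ENNReal.ofReal t * c + ∫⁻ x, (‖f x‖ₑ - c) ∂μ :=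
  iInf_le _ c

theorem kFunctional_le_lintegral (f : Ω → G) (t : ℝ) : kFunctional μ f t ≤ ∫⁻ x, ‖f x‖ₑ ∂μ := by
  simpa using kFunctional_le_add (μ := μ) f t 0

theorem kFunctional_le_mul_eLpNormEssSup (f : Ω → G) (t : ℝ) :
    kFunctional μ f t ≤ ENNReal.ofReal t * eLpNormEssSup f μ := by
  have h : ∫⁻ x, (‖f x‖ₑ - eLpNormEssSup f μ) ∂μ = 0 := by
    rw [← lintegral_zero (μ := μ)]
    refine lintegral_congr_ae ?_
    filter_upwards [enorm_ae_le_eLpNormEssSup f μ] with x hx using tsub_eq_zero_of_le hx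
  simpa [h] using kFunctional_le_add (μ := μ) f t (eLpNormEssSup f μ)

theorem monotone_kFunctional (f : Ω → G) : Monotone (kFunctional μ f) := fun s t hst =>
  iInf_mono fun c => by gcongr

theorem measurable_rpow_mul_kFunctional (f : Ω → G) :
    Measurable fun t => ENNReal.ofReal (t ^ (-1 - θ)) * kFunctional μ f t :=
  Measurable.mul (by fun_prop) (monotone_kFunctional f).measurable

theorem interpNorm_mono_ae {f g : Ω → G} (h : ∀ᵐ x ∂μ, ‖f x‖ₑ ≤ ‖g x‖ₑ) :
    interpNorm μ θ f ≤ interpNorm μ θ g := by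
  unfold interpNorm kFunctional
  gcongr ∫⁻ t in _, _ * ⨅ c, (_ + ?_) with t c
  exact lintegral_mono_ae (h.mono fun x hx => tsub_le_tsub_right hx c)

theorem kFunctional_le_tsum {ι : Type*} [Countable ι] {f : Ω → G} {g : ι → Ω → G}
    (hg : ∀ i, AEStronglyMeasurable (g i) μ) (hfg : ∀ᵐ x ∂μ, ‖f x‖ₑ ≤ ∑' i, ‖g i x‖ₑ) (t : ℝ) :
    kFunctional μ f t ≤ ∑' i, kFunctional μ (g i) t := by
  refine ENNReal.le_of_forall_pos_le_add fun ε hε hfin => ?_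
  obtain ⟨δ, hδ, hδε⟩ := ENNReal.exists_pos_sum_of_countable' (ENNReal.coe_pos.2 hε).ne' ι
  have hnear : ∀ i, ∃ c : ℝ≥0∞, ENNReal.ofReal t * c + ∫⁻ x, (‖g i x‖ₑ - c) ∂μ <
      kFunctional μ (g i) t + δ i := fun i =>
    iInf_lt_iff.1 (ENNReal.lt_add_right (ENNReal.ne_top_of_tsum_ne_top hfin.ne i) (hδ i).ne')
  choose c hc using hnear
  have htrunc : ∫⁻ x, (‖f x‖ₑ - ∑' i, c i) ∂μ ≤ ∑' i, ∫⁻ x, (‖g i x‖ₑ - c i) ∂μ := by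
    rw [← lintegral_tsum fun i => (hg i).enorm.sub_const _]
    refine lintegral_mono_ae (hfg.mono fun x hx => tsub_le_iff_right.2 (hx.trans ?_))
    rw [← ENNReal.tsum_add]
    exact ENNReal.tsum_le_tsum fun i => le_tsub_add
  calc kFunctional μ f t ≤ ENNReal.ofReal t * ∑' i, c i + ∫⁻ x, (‖f x‖ₑ - ∑' i, c i) ∂μ :=
        kFunctional_le_add f t _
    _ ≤ ∑' i, (ENNReal.ofReal t * c i + ∫⁻ x, (‖g i x‖ₑ - c i) ∂μ) := by
        rw [ENNReal.tsum_add, ENNReal.tsum_mul_left]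
        gcongr
    _ ≤ ∑' i, (kFunctional μ (g i) t + δ i) := ENNReal.tsum_le_tsum fun i => (hc i).le
    _ ≤ ∑' i, kFunctional μ (g i) t + ε := by
        rw [ENNReal.tsum_add]
        gcongr

theorem interpNorm_le_tsum {ι : Type*} [Countable ι] {f : Ω → G} {g : ι → Ω → G}
    (hg : ∀ i, AEStronglyMeasurable (g i) μ) (hfg : ∀ᵐ x ∂μ, ‖f x‖ₑ ≤ ∑' i, ‖g i x‖ₑ) :
    interpNorm μ θ f ≤ ∑' i, interpNorm μ θ (g i) := by
  unfold interpNorm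
  rw [← lintegral_tsum fun i => (measurable_rpow_mul_kFunctional (g i)).aemeasurable]
  gcongr with t
  rw [ENNReal.tsum_mul_left]
  gcongr
  exact kFunctional_le_tsum hg hfg t

theorem lintegral_Ioc_rpow_neg (hθ : θ < 1) {T : ℝ} (hT : 0 ≤ T) :
    ∫⁻ t in Ioc 0 T, ENNReal.ofReal (t ^ (-θ)) = ENNReal.ofReal (T ^ (1 - θ) / (1 - θ)) := by
  have hint : IntervalIntegrable (fun t : ℝ => t ^ (-θ)) volume 0 T :=
    intervalIntegral.intervalIntegrable_rpow' (by linarith)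
  rw [← ofReal_integral_eq_lintegral_ofReal hint.1
    ((ae_restrict_mem measurableSet_Ioc).mono fun t ht => Real.rpow_nonneg ht.1.le _),
    ← intervalIntegral.integral_of_le hT, integral_rpow (Or.inl (by linarith)),
    Real.zero_rpow (by linarith), sub_zero, neg_add_eq_sub]

theorem lintegral_Ioi_rpow_neg_one_sub (hθ : 0 < θ) {T : ℝ} (hT : 0 < T) :
    ∫⁻ t in Ioi T, ENNReal.ofReal (t ^ (-1 - θ)) = ENNReal.ofReal (T ^ (-θ) / θ) := by
  rw [← ofReal_integral_eq_lintegral_ofReal (integrableOn_Ioi_rpow_of_lt (by linarith) hT)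
    ((ae_restrict_mem measurableSet_Ioi).mono fun t ht => Real.rpow_nonneg (hT.trans ht).le _),
    integral_Ioi_rpow_of_lt (by linarith) hT, show -1 - θ + 1 = -θ by ring, neg_div_neg_eq]

theorem lintegral_rpow_mul_min_le_ofReal (hθ₀ : 0 < θ) (hθ₁ : θ < 1) {A B : ℝ} (hA : 0 < A)
    (hB : 0 < B) :
    ∫⁻ t in Ioi (0 : ℝ), ENNReal.ofReal (t ^ (-1 - θ)) *
        min (ENNReal.ofReal A) (ENNReal.ofReal t * ENNReal.ofReal B) ≤
      ENNReal.ofReal (1 / (1 - θ) + 1 / θ) * ENNReal.ofReal (A ^ (1 - θ) * B ^ θ) := by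
  have hT : 0 < A / B := by positivity
  have hθ : 0 < 1 - θ := by linarith
  have hlow : ∫⁻ t in Ioc 0 (A / B), ENNReal.ofReal (t ^ (-1 - θ)) *
      min (ENNReal.ofReal A) (ENNReal.ofReal t * ENNReal.ofReal B) ≤
      ENNReal.ofReal (B * ((A / B) ^ (1 - θ) / (1 - θ))) := by
    rw [ENNReal.ofReal_mul hB.le, ← lintegral_Ioc_rpow_neg hθ₁ hT.le,
      ← lintegral_const_mul _ (by fun_prop)]
    refine setLIntegral_mono' measurableSet_Ioc fun t ht => ?_
    calc _ ≤ ENNReal.ofReal (t ^ (-1 - θ)) * (ENNReal.ofReal t * ENNReal.ofReal B) := by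
          gcongr; exact min_le_right _ _
      _ = ENNReal.ofReal B * ENNReal.ofReal (t ^ (-θ)) := by
          rw [← mul_assoc, ← ENNReal.ofReal_mul (Real.rpow_nonneg ht.1.le _),
            ← Real.rpow_add_one ht.1.ne', mul_comm]
          ring_nf
  have hhigh : ∫⁻ t in Ioi (A / B), ENNReal.ofReal (t ^ (-1 - θ)) *
      min (ENNReal.ofReal A) (ENNReal.ofReal t * ENNReal.ofReal B) ≤
      ENNReal.ofReal (A * ((A / B) ^ (-θ) / θ)) := by
    rw [ENNReal.ofReal_mul hA.le, ← lintegral_Ioi_rpow_neg_one_sub hθ₀ hT,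
      ← lintegral_const_mul _ (by fun_prop)]
    refine lintegral_mono fun t => ?_
    rw [mul_comm]
    gcongr
    exact min_le_left _ _
  rw [← Ioc_union_Ioi_eq_Ioi hT.le]
  refine (lintegral_union_le _ _ _).trans ((add_le_add hlow hhigh).trans (le_of_eq ?_))
  rw [← ENNReal.ofReal_add (by positivity) (by positivity), ← ENNReal.ofReal_mul (by positivity),
    Real.div_rpow hA.le hB.le, Real.div_rpow hA.le hB.le, Real.rpow_sub hA, Real.rpow_sub hB,
    Real.rpow_one, Real.rpow_one, Real.rpow_neg hA.le, Real.rpow_neg hB.le]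
  congr 1
  field_simp

theorem lintegral_rpow_mul_min_le (hθ₀ : 0 < θ) (hθ₁ : θ < 1) (A B : ℝ≥0∞) :
    ∫⁻ t in Ioi (0 : ℝ), ENNReal.ofReal (t ^ (-1 - θ)) * min A (ENNReal.ofReal t * B) ≤
      ENNReal.ofReal (1 / (1 - θ) + 1 / θ) * (A ^ (1 - θ) * B ^ θ) := by
  have hθ : 0 < 1 - θ := by linarith
  have hconst : ENNReal.ofReal (1 / (1 - θ) + 1 / θ) * ⊤ = ⊤ :=
    ENNReal.mul_top (by rw [Ne, ENNReal.ofReal_eq_zero, not_le]; positivity)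
  rcases eq_or_ne A 0 with rfl | hA₀
  · simp
  rcases eq_or_ne B 0 with rfl | hB₀
  · simp
  rcases eq_or_ne A ⊤ with rfl | hA
  · rw [ENNReal.top_rpow_of_pos hθ, ENNReal.top_mul (by simp [hB₀, hθ₀.not_gt]), hconst]
    exact le_top
  rcases eq_or_ne B ⊤ with rfl | hB
  · rw [ENNReal.top_rpow_of_pos hθ₀, ENNReal.mul_top (by simp [hA₀, hθ.not_gt]), hconst]
    exact le_top
  have h := lintegral_rpow_mul_min_le_ofReal hθ₀ hθ₁ (ENNReal.toReal_pos hA₀ hA)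
    (ENNReal.toReal_pos hB₀ hB)
  rwa [ENNReal.ofReal_mul (by positivity), ← ENNReal.ofReal_rpow_of_nonneg (by simp) hθ.le,
    ← ENNReal.ofReal_rpow_of_nonneg (by simp) hθ₀.le, ENNReal.ofReal_toReal hA,
    ENNReal.ofReal_toReal hB] at h

theorem interpNorm_le_rpow_mul_rpow (hθ₀ : 0 < θ) (hθ₁ : θ < 1) (f : Ω → G) :
    interpNorm μ θ f ≤ ENNReal.ofReal (1 / (1 - θ) + 1 / θ) *
      ((∫⁻ x, ‖f x‖ₑ ∂μ) ^ (1 - θ) * eLpNormEssSup f μ ^ θ) := by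
  refine le_trans ?_ (lintegral_rpow_mul_min_le hθ₀ hθ₁ _ _)
  unfold interpNorm
  gcongr with t
  exact le_min (kFunctional_le_lintegral f t) (kFunctional_le_mul_eLpNormEssSup f t)

end Interpolation

section Lorentz

variable {d : ℕ} {G : Type*} [NormedAddCommGroup G]

theorem antitone_distribFun (f : EuclideanSpace ℝ (Fin d) → G) : Antitone (distribFun f) :=
  fun _ _ h => measure_mono fun _ hx => lt_of_le_of_lt h hx

theorem rearrangement_le_of_distribFun_lt {f : EuclideanSpace ℝ (Fin d) → G} {y : ℝ≥0} {t : ℝ}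
    (h : distribFun f y < ENNReal.ofReal t) : rearrangement f t ≤ y :=
  iInf₂_le y h

theorem lintegral_enorm_sub_eq_lintegral_distribFun {f : EuclideanSpace ℝ (Fin d) → G}
    (hf : AEStronglyMeasurable f) (c : ℝ≥0) :
    ∫⁻ x, (‖f x‖ₑ - c) = ∫⁻ y in Ioi (0 : ℝ), distribFun f (c + y.toNNReal) := by
  have hreal : ∀ x, ‖f x‖ₑ - c = ENNReal.ofReal (max (‖f x‖ - c) 0) := fun x => by
    rw [ENNReal.ofReal_max, ENNReal.ofReal_sub _ (NNReal.coe_nonneg c), ofReal_norm]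
    simp
  have hmeas : AEMeasurable (fun x => max (‖f x‖ - c) (0 : ℝ)) :=
    (hf.norm.aemeasurable.sub_const _).max aemeasurable_const
  have hnonneg : 0 ≤ᵐ[volume] fun x => max (‖f x‖ - c) (0 : ℝ) :=
    ae_of_all _ fun x => le_max_right _ _
  simp only [hreal]
  rw [lintegral_eq_lintegral_meas_lt _ hnonneg hmeas]
  refine setLIntegral_congr_fun measurableSet_Ioi fun y (hy : 0 < y) => ?_
  refine congrArg _ (Set.ext fun x => ?_)
  rw [mem_ofPred_eq, mem_ofPred_eq, lt_max_iff, or_iff_left hy.not_gt, lt_sub_iff_add_lt',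
    ← NNReal.coe_lt_coe, NNReal.coe_add, Real.coe_toNNReal _ hy.le, coe_nnnorm]

theorem rearrangement_le_add_volume (f : EuclideanSpace ℝ (Fin d) → G) (c : ℝ≥0) (s : ℝ) :
    rearrangement f s ≤
      c + volume (Ioi 0 ∩ {y : ℝ | ENNReal.ofReal s ≤ distribFun f (c + y.toNNReal)}) := by
  refine ENNReal.le_of_forall_nnreal_lt fun r hr => ?_
  rw [← tsub_le_iff_left, ← ENNReal.coe_sub]
  have hvol : ((r - c : ℝ≥0) : ℝ≥0∞) = volume (Ioo (0 : ℝ) (r - c : ℝ≥0)) := by simp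
  refine hvol.trans_le (measure_mono fun y hy => ⟨hy.1, mem_ofPred.2 (not_lt.1 fun hlt => ?_)⟩)
  have hy' : y.toNNReal < r - c := (Real.toNNReal_lt_iff_lt_coe hy.1.le).2 hy.2
  exact (hr.trans_le (rearrangement_le_of_distribFun_lt hlt)).not_ge
    (ENNReal.coe_le_coe.2 (lt_tsub_iff_left.1 hy').le)

theorem volume_Ioi_inter_ofReal_le (m : ℝ≥0∞) :
    volume (Ioi (0 : ℝ) ∩ {s | ENNReal.ofReal s ≤ m}) ≤ m := by
  rcases eq_or_ne m ⊤ with rfl | hm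
  · exact le_top
  · calc volume (Ioi (0 : ℝ) ∩ {s | ENNReal.ofReal s ≤ m}) ≤ volume (Ioc 0 m.toReal) :=
        measure_mono fun s hs => ⟨hs.1, (ENNReal.ofReal_le_iff_le_toReal hm).1 hs.2⟩
      _ = m := by simp [ENNReal.ofReal_toReal hm]

theorem lintegral_rearrangement_le_kFunctional {f : EuclideanSpace ℝ (Fin d) → G}
    (hf : AEStronglyMeasurable f) {t : ℝ} (ht : 0 < t) :
    ∫⁻ s in Ioc 0 t, rearrangement f s ≤ kFunctional volume f t := by
  refine le_iInf fun c => ?_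
  induction c using ENNReal.recTopCoe with
  | top => simp [ENNReal.mul_top, ht]
  | coe c =>
    set D : Set (ℝ × ℝ) := {p | ENNReal.ofReal p.1 ≤ distribFun f (c + p.2.toNNReal)}
    have hD : MeasurableSet D := by
      have hmono : Antitone fun y : ℝ => distribFun f (c + y.toNNReal) :=
        (antitone_distribFun f).comp_monotone fun a b h => by gcongr
      exact measurableSet_le (by fun_prop) (hmono.measurable.comp measurable_snd)
    calc ∫⁻ s in Ioc 0 t, rearrangement f s
        ≤ ∫⁻ s in Ioc 0 t, (c + volume (Ioi 0 ∩ Prod.mk s ⁻¹' D)) :=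
          lintegral_mono fun s => rearrangement_le_add_volume f c s
      _ ≤ ENNReal.ofReal t * c + ∫⁻ s in Ioi 0, volume (Ioi 0 ∩ Prod.mk s ⁻¹' D) := by
          rw [lintegral_add_left measurable_const, setLIntegral_const, Real.volume_Ioc, sub_zero,
            mul_comm]
          gcongr
          exact Ioc_subset_Ioi_self
      _ = ENNReal.ofReal t * c + ∫⁻ y in Ioi 0, volume (Ioi 0 ∩ (fun s => (s, y)) ⁻¹' D) := by
          congr 1
          have h₁ := Measure.prod_apply (μ := volume.restrict (Ioi (0 : ℝ)))
            (ν := volume.restrict (Ioi (0 : ℝ))) hD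
          rw [Measure.prod_apply_symm hD] at h₁
          simpa only [Measure.restrict_apply (measurable_prodMk_left hD),
            Measure.restrict_apply (measurable_prodMk_right hD), inter_comm _ (Ioi (0 : ℝ))]
            using h₁.symm
      _ ≤ ENNReal.ofReal t * c + ∫⁻ y in Ioi (0 : ℝ), distribFun f (c + y.toNNReal) := by
          gcongr with y
          exact volume_Ioi_inter_ofReal_le _
      _ = _ := by rw [lintegral_enorm_sub_eq_lintegral_distribFun hf]

theorem lorentzNorm_le_interpNorm {f : EuclideanSpace ℝ (Fin d) → G}
    (hf : AEStronglyMeasurable f) {q θ : ℝ} (hq : 1 / q = 1 - θ) :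
    lorentzNorm q 1 f ≤ interpNorm volume θ f := by
  simp only [lorentzNorm, maximalRearrangement, ENNReal.rpow_one, div_one]
  refine setLIntegral_mono' measurableSet_Ioi fun t (ht : 0 < t) => ?_
  calc _ = ENNReal.ofReal (t ^ (1 / q)) * (ENNReal.ofReal t)⁻¹ * (ENNReal.ofReal t)⁻¹ *
        ∫⁻ s in Ioc 0 t, rearrangement f s := by
        simp only [div_eq_mul_inv]; ring
    _ = ENNReal.ofReal (t ^ (-1 - θ)) * ∫⁻ s in Ioc 0 t, rearrangement f s := by
        rw [hq, ← ENNReal.ofReal_inv_of_pos ht, ← ENNReal.ofReal_mul (by positivity),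
          ← ENNReal.ofReal_mul (by positivity), show -1 - θ = (1 - θ) - 1 - 1 by ring,
          Real.rpow_sub_one ht.ne', Real.rpow_sub_one ht.ne']
        simp only [div_eq_mul_inv]
    _ ≤ _ := by gcongr; exact lintegral_rearrangement_le_kFunctional hf ht

end Lorentz

/-! ### Gradients, rescaling and convolutions -/

section Gradient

variable {E : Type*} [NormedAddCommGroup E] [InnerProductSpace ℝ E] [CompleteSpace E] {u : E → ℝ}

theorem norm_gradient (u : E → ℝ) (x : E) : ‖∇ u x‖ = ‖fderiv ℝ u x‖ := by
  rw [← toDual_gradient, LinearIsometryEquiv.norm_map]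

theorem enorm_gradient (u : E → ℝ) (x : E) : ‖∇ u x‖ₑ = ‖fderiv ℝ u x‖ₑ := by
  rw [← ofReal_norm, ← ofReal_norm, norm_gradient]

theorem continuous_gradient (hu : ContDiff ℝ 1 u) : Continuous (∇ u) :=
  (InnerProductSpace.toDual ℝ E).symm.continuous.comp (hu.continuous_fderiv (by simp))

theorem hasCompactSupport_gradient (hu : HasCompactSupport u) : HasCompactSupport (∇ u) :=
  (hu.fderiv (𝕜 := ℝ)).comp_left (g := (InnerProductSpace.toDual ℝ E).symm) (map_zero _)

theorem integrable_gradient [MeasurableSpace E] [BorelSpace E] {μ : Measure E}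
    [IsFiniteMeasureOnCompacts μ] (hu : ContDiff ℝ 1 u) (hcu : HasCompactSupport u) :
    Integrable (∇ u) μ :=
  (continuous_gradient hu).integrable_of_hasCompactSupport (hasCompactSupport_gradient hcu)

theorem gradient_comp {φ : ℝ → ℝ} {φ' : ℝ} {x : E} (hφ : HasDerivAt φ φ' (u x))
    (hu : DifferentiableAt ℝ u x) : ∇ (φ ∘ u) x = φ' • ∇ u x :=
  HasGradientAt.gradient <| hasGradientAt_iff_hasFDerivAt.2 <|
    (hφ.comp_hasFDerivAt x hu.hasFDerivAt).congr_fderiv <| by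
      rw [map_smul, toDual_gradient]

end Gradient

/-- The dilate `x ↦ s ^ (-β) k(x / s)`; it preserves the `L¹` norm when `β` is the dimension. -/
noncomputable def rescale {E : Type*} [AddCommGroup E] [Module ℝ E] (β : ℝ) (k : E → ℝ) (s : ℝ)
    (x : E) : ℝ :=
  s ^ (-β) * k (s⁻¹ • x)

section Rescale

variable {E : Type*} [NormedAddCommGroup E] [NormedSpace ℝ E] {k : E → ℝ} {β s : ℝ}

theorem contDiff_rescale {n : WithTop ℕ∞} (hk : ContDiff ℝ n k) : ContDiff ℝ n (rescale β k s) :=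
  contDiff_const.mul (hk.comp (contDiff_const_smul _))

theorem continuous_rescale (hk : Continuous k) : Continuous (rescale β k s) :=
  continuous_const.mul (hk.comp (continuous_const_smul _))

theorem hasCompactSupport_rescale (hk : HasCompactSupport k) (hs : s ≠ 0) :
    HasCompactSupport (rescale β k s) :=
  (hk.comp_smul (inv_ne_zero hs)).mul_left

theorem fderiv_rescale (β : ℝ) (k : E → ℝ) (hs : 0 < s) (x : E) :
    fderiv ℝ (rescale β k s) x = s ^ (-β - 1) • fderiv ℝ k (s⁻¹ • x) := by
  have hsmul : rescale β k s = s ^ (-β) • fun x => k (s⁻¹ • x) := rfl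
  rw [hsmul, fderiv_const_smul_field, Pi.smul_apply, fderiv_comp_smul, smul_smul,
    Real.rpow_sub_one hs.ne', div_eq_mul_inv]

variable [FiniteDimensional ℝ E] [MeasurableSpace E] [BorelSpace E] (μ : Measure E)
  [μ.IsAddHaarMeasure]

theorem lintegral_comp_inv_smul (f : E → ℝ≥0∞) (hs : 0 < s) :
    ∫⁻ x, f (s⁻¹ • x) ∂μ = ENNReal.ofReal (s ^ finrank ℝ E) * ∫⁻ x, f x ∂μ := by
  have hs' : s⁻¹ ≠ 0 := (inv_pos.2 hs).ne'
  let e := (Homeomorph.smulOfNeZero (α := E) s⁻¹ hs').toMeasurableEquiv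
  have hmap : μ.map e = ENNReal.ofReal (s ^ finrank ℝ E) • μ := by
    have h := Measure.map_addHaar_smul μ hs'
    rwa [inv_pow, inv_inv, abs_of_pos (by positivity)] at h
  have h := lintegral_map_equiv (μ := μ) f e
  rw [hmap, lintegral_smul_measure] at h
  exact h.symm

theorem lintegral_enorm_rescale (β : ℝ) (k : E → ℝ) (hs : 0 < s) :
    ∫⁻ x, ‖rescale β k s x‖ₑ ∂μ = ENNReal.ofReal (s ^ (finrank ℝ E - β)) * ∫⁻ x, ‖k x‖ₑ ∂μ := by
  simp only [rescale, enorm_mul]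
  rw [lintegral_const_mul' _ _ enorm_ne_top, lintegral_comp_inv_smul μ (fun x => ‖k x‖ₑ) hs,
    ← mul_assoc, Real.enorm_of_nonneg (Real.rpow_nonneg hs.le _),
    ← ENNReal.ofReal_mul (Real.rpow_nonneg hs.le _), ← Real.rpow_natCast, ← Real.rpow_add hs,
    neg_add_eq_sub]

theorem integral_rescale (β : ℝ) (k : E → ℝ) (hs : 0 < s) :
    ∫ x, rescale β k s x ∂μ = s ^ (finrank ℝ E - β) * ∫ x, k x ∂μ := by
  simp only [rescale]
  rw [integral_const_mul, Measure.integral_comp_inv_smul_of_nonneg μ k hs.le, smul_eq_mul,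
    ← mul_assoc, ← Real.rpow_natCast, ← Real.rpow_add hs, neg_add_eq_sub]

end Rescale

section RescaleGradient

variable {E : Type*} [NormedAddCommGroup E] [InnerProductSpace ℝ E] {β s : ℝ}

theorem gradient_rescale [CompleteSpace E] (β : ℝ) (k : E → ℝ) (hs : 0 < s) (x : E) :
    ∇ (rescale β k s) x = s ^ (-β - 1) • ∇ k (s⁻¹ • x) := by
  rw [gradient, gradient, fderiv_rescale β k hs, map_smulₛₗ]
  rfl

theorem enorm_gradient_rescale [CompleteSpace E] (β : ℝ) (k : E → ℝ) (hs : 0 < s) (x : E) :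
    ‖∇ (rescale β k s) x‖ₑ = ENNReal.ofReal (s ^ (-β - 1)) * ‖∇ k (s⁻¹ • x)‖ₑ := by
  rw [gradient_rescale β k hs, enorm_smul, Real.enorm_of_nonneg (Real.rpow_nonneg hs.le _)]

theorem lintegral_enorm_gradient_rescale [FiniteDimensional ℝ E] [MeasurableSpace E]
    [BorelSpace E] (μ : Measure E) [μ.IsAddHaarMeasure] (β : ℝ) (k : E → ℝ) (hs : 0 < s) :
    ∫⁻ x, ‖∇ (rescale β k s) x‖ₑ ∂μ =
      ENNReal.ofReal (s ^ (finrank ℝ E - β - 1)) * ∫⁻ x, ‖∇ k x‖ₑ ∂μ := by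
  simp only [enorm_gradient_rescale β k hs]
  rw [lintegral_const_mul' _ _ ENNReal.ofReal_ne_top,
    lintegral_comp_inv_smul μ (fun x => ‖∇ k x‖ₑ) hs,
    ← mul_assoc, ← ENNReal.ofReal_mul (Real.rpow_nonneg hs.le _), ← Real.rpow_natCast,
    ← Real.rpow_add hs]
  congr 3
  ring

end RescaleGradient

section Convolution

variable {E : Type*} [NormedAddCommGroup E] [InnerProductSpace ℝ E] [FiniteDimensional ℝ E]
  [MeasurableSpace E] [BorelSpace E]
  {V : Type*} [NormedAddCommGroup V] [NormedSpace ℝ V]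

theorem aestronglyMeasurable_convolution {K : E → ℝ} {F : E → V} (hK : AEStronglyMeasurable K)
    (hF : AEStronglyMeasurable F) : AEStronglyMeasurable (K ⋆ F) :=
  (hK.convolution_integrand (ContinuousLinearMap.lsmul ℝ ℝ) hF).integral_prod_right'

theorem lintegral_enorm_convolution_le {K : E → ℝ} {F : E → V} (hK : AEStronglyMeasurable K)
    (hF : AEStronglyMeasurable F) :
    ∫⁻ x, ‖(K ⋆ F) x‖ₑ ≤ (∫⁻ x, ‖K x‖ₑ) * ∫⁻ x, ‖F x‖ₑ := by
  have hmeas := (hK.convolution_integrand (ContinuousLinearMap.lsmul ℝ ℝ) hF).enorm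
  calc ∫⁻ x, ‖(K ⋆ F) x‖ₑ ≤ ∫⁻ x, ∫⁻ y, ‖K y • F (x - y)‖ₑ :=
        lintegral_mono fun x => enorm_integral_le_lintegral_enorm _
    _ = ∫⁻ y, ∫⁻ x, ‖K y • F (x - y)‖ₑ := lintegral_lintegral_swap hmeas
    _ = ∫⁻ y, ‖K y‖ₑ * ∫⁻ x, ‖F x‖ₑ := by
        refine lintegral_congr fun y => ?_
        simp only [enorm_smul]
        rw [lintegral_const_mul' _ _ enorm_ne_top,
          lintegral_sub_right_eq_self (fun x => ‖F x‖ₑ) y]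
    _ = _ := lintegral_mul_const'' _ hK.enorm

theorem enorm_convolution_le_mul_lintegral {K : E → ℝ} {F : E → V} {C : ℝ≥0∞}
    (hK : ∀ x, ‖K x‖ₑ ≤ C) (hF : AEStronglyMeasurable F) (x : E) :
    ‖(K ⋆ F) x‖ₑ ≤ C * ∫⁻ y, ‖F y‖ₑ := by
  calc ‖(K ⋆ F) x‖ₑ ≤ ∫⁻ y, ‖K y • F (x - y)‖ₑ := enorm_integral_le_lintegral_enorm _
    _ ≤ ∫⁻ y, C * ‖F (x - y)‖ₑ := by
        refine lintegral_mono fun y => ?_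
        rw [enorm_smul]
        gcongr
        exact hK y
    _ = C * ∫⁻ y, ‖F (x - y)‖ₑ := lintegral_const_mul'' _
        (hF.comp_measurePreserving (Measure.measurePreserving_sub_left volume x)).enorm
    _ = _ := by rw [lintegral_sub_left_eq_self (fun y => ‖F y‖ₑ) x]

theorem enorm_convolution_le_lintegral_mul {K : E → ℝ} {F : E → V} {C : ℝ≥0∞}
    (hK : AEStronglyMeasurable K) (hF : ∀ x, ‖F x‖ₑ ≤ C) (x : E) :
    ‖(K ⋆ F) x‖ₑ ≤ (∫⁻ y, ‖K y‖ₑ) * C := by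
  calc ‖(K ⋆ F) x‖ₑ ≤ ∫⁻ y, ‖K y • F (x - y)‖ₑ := enorm_integral_le_lintegral_enorm _
    _ ≤ ∫⁻ y, ‖K y‖ₑ * C := by
        refine lintegral_mono fun y => ?_
        rw [enorm_smul]
        gcongr
        exact hF _
    _ = _ := lintegral_mul_const'' _ hK.enorm

theorem hasGradientAt_convolution {K v : E → ℝ} (hK : LocallyIntegrable K) (hv : ContDiff ℝ 1 v)
    (hcv : HasCompactSupport v) (x : E) : HasGradientAt (K ⋆ v) ((K ⋆ ∇ v) x) x := by
  refine hasGradientAt_iff_hasFDerivAt.2 ((hcv.hasFDerivAt_convolution_right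
    (ContinuousLinearMap.lsmul ℝ ℝ) hK hv x).congr_fderiv (ContinuousLinearMap.ext fun w => ?_))
  have hint := (hasCompactSupport_gradient hcv).convolutionExists_right
    (ContinuousLinearMap.lsmul ℝ ℝ) hK (continuous_gradient hv) x
  rw [convolution_precompR_apply _ hK (hcv.fderiv ℝ) (hv.continuous_fderiv (by simp)),
    InnerProductSpace.toDual_apply_apply, real_inner_comm, convolution_def, convolution_def,
    ← integral_inner hint]
  simp only [ContinuousLinearMap.lsmul_apply, inner_smul_right, ← inner_gradient_left,
    real_inner_comm w, smul_eq_mul]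

theorem convolution_gradient_comm {K v : E → ℝ} (hK : ContDiff ℝ 1 K) (hcK : HasCompactSupport K)
    (hv : ContDiff ℝ 1 v) (hcv : HasCompactSupport v) : K ⋆ ∇ v = v ⋆ ∇ K := by
  have hflip : K ⋆ v = v ⋆ K := by
    rw [← convolution_flip]
    congr 1
    ext
    simp
  funext x
  have h₁ := (hasGradientAt_convolution hK.continuous.locallyIntegrable hv hcv x).gradient
  have h₂ := (hasGradientAt_convolution hv.continuous.locallyIntegrable hK hcK x).gradient
  rw [← h₁, ← h₂, hflip]

end Convolution

section Series

variable {Ω V : Type*} [MeasurableSpace Ω] {μ : Measure Ω} [NormedAddCommGroup V]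
  [NormedSpace ℝ V] {ι : Type*} [Countable ι] {f : ι → Ω → V} {g : Ω → V}

theorem enorm_integral_le_tsum (hf : ∀ i, AEStronglyMeasurable (f i) μ)
    (hsum : ∑' i, ∫⁻ y, ‖f i y‖ₑ ∂μ ≠ ⊤) (hfg : ∀ᵐ y ∂μ, HasSum (fun i => f i y) (g y)) :
    ‖∫ y, g y ∂μ‖ₑ ≤ ∑' i, ‖∫ y, f i y ∂μ‖ₑ := by
  have heq : ∫ y, g y ∂μ = ∑' i, ∫ y, f i y ∂μ := by
    rw [← integral_tsum hf hsum]
    exact integral_congr_ae (hfg.mono fun y hy => hy.tsum_eq.symm)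
  rw [heq]
  exact enorm_tsum_le_tsum_enorm

end Series

/-! ### Dyadic decompositions and the Riesz kernel -/

section DyadicPartition

variable {E : Type*} [NormedAddCommGroup E]

/-- A smooth radial cutoff that vanishes for `‖x‖ ≤ 1` and equals `1` for `‖x‖ ≥ 2`. -/
noncomputable def dyadicCutoff (x : E) : ℝ := Real.smoothTransition (‖x‖ ^ 2 - 1)

theorem dyadicCutoff_nonneg (x : E) : 0 ≤ dyadicCutoff x := Real.smoothTransition.nonneg _

theorem dyadicCutoff_le_one (x : E) : dyadicCutoff x ≤ 1 := Real.smoothTransition.le_one _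

theorem dyadicCutoff_eq_zero {x : E} (hx : ‖x‖ ≤ 1) : dyadicCutoff x = 0 :=
  Real.smoothTransition.zero_of_nonpos (by nlinarith [norm_nonneg x])

theorem dyadicCutoff_eq_one {x : E} (hx : 2 ≤ ‖x‖) : dyadicCutoff x = 1 :=
  Real.smoothTransition.one_of_one_le (by nlinarith)

theorem dyadicCutoff_mono {x y : E} (h : ‖x‖ ≤ ‖y‖) : dyadicCutoff x ≤ dyadicCutoff y :=
  Real.smoothTransition.monotone (by gcongr)

variable [InnerProductSpace ℝ E]

theorem contDiff_dyadicCutoff : ContDiff ℝ ∞ (dyadicCutoff : E → ℝ) :=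
  Real.smoothTransition.contDiff.comp ((contDiff_norm_sq ℝ).sub contDiff_const)

/-- The radial bump on `1 ≤ ‖x‖ ≤ 4` whose dilates by the powers of `2` form a partition of unity
on `E \ {0}`. -/
noncomputable def dyadicBump (x : E) : ℝ := dyadicCutoff x - dyadicCutoff ((2 : ℝ)⁻¹ • x)

theorem contDiff_dyadicBump : ContDiff ℝ ∞ (dyadicBump : E → ℝ) :=
  contDiff_dyadicCutoff.sub (contDiff_dyadicCutoff.comp (contDiff_const_smul _))

theorem norm_two_inv_smul (x : E) : ‖(2 : ℝ)⁻¹ • x‖ = ‖x‖ / 2 := by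
  rw [norm_smul, norm_inv, Real.norm_two, inv_mul_eq_div]

theorem dyadicBump_nonneg (x : E) : 0 ≤ dyadicBump x :=
  sub_nonneg.2 (dyadicCutoff_mono (by rw [norm_two_inv_smul]; linarith [norm_nonneg x]))

theorem dyadicBump_eq_zero_of_norm_le_one {x : E} (hx : ‖x‖ ≤ 1) : dyadicBump x = 0 := by
  rw [dyadicBump, dyadicCutoff_eq_zero hx, dyadicCutoff_eq_zero, sub_self]
  rw [norm_two_inv_smul]
  linarith

theorem dyadicBump_eq_zero_of_four_le_norm {x : E} (hx : 4 ≤ ‖x‖) : dyadicBump x = 0 := by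
  rw [dyadicBump, dyadicCutoff_eq_one (by linarith), dyadicCutoff_eq_one, sub_self]
  rw [norm_two_inv_smul]
  linarith

theorem hasCompactSupport_dyadicBump [FiniteDimensional ℝ E] :
    HasCompactSupport (dyadicBump : E → ℝ) :=
  HasCompactSupport.intro (isCompact_closedBall 0 4) fun x hx =>
    dyadicBump_eq_zero_of_four_le_norm (by simpa using (not_le.1 (by simpa using hx)).le)

theorem hasSum_int_sub_of_antitone {a : ℤ → ℝ} (ha : Antitone a) {L₀ L₁ : ℝ}
    (h₀ : Tendsto a atTop (𝓝 L₀)) (h₁ : Tendsto a atBot (𝓝 L₁)) :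
    HasSum (fun j : ℤ => a j - a (j + 1)) (L₁ - L₀) := by
  have hnonneg : ∀ j, 0 ≤ a j - a (j + 1) := fun j => sub_nonneg.2 (ha (by lia))
  have hpos : HasSum (fun n : ℕ => a n - a (n + 1)) (a 0 - L₀) := by
    rw [hasSum_iff_tendsto_nat_of_nonneg (fun n => hnonneg n)]
    refine ((h₀.comp tendsto_natCast_atTop_atTop).const_sub (a 0)).congr fun n => ?_
    simpa using (Finset.sum_range_sub' (fun i : ℕ => a i) n).symm
  have hneg : HasSum (fun n : ℕ => a (-((n : ℤ) + 1)) - a (-((n : ℤ) + 1) + 1)) (L₁ - a 0) := by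
    rw [hasSum_iff_tendsto_nat_of_nonneg (fun n => hnonneg _)]
    have hbot : Tendsto (fun n : ℕ => -(n : ℤ)) atTop atBot :=
      tendsto_neg_atTop_atBot.comp tendsto_natCast_atTop_atTop
    refine ((h₁.comp hbot).sub_const (a 0)).congr fun n => ?_
    simpa [neg_add_cancel_right, neg_add_rev, add_comm] using
      (Finset.sum_range_sub (fun i : ℕ => a (-(i : ℤ))) n).symm
  simpa using HasSum.of_nat_of_neg_add_one (f := fun j : ℤ => a j - a (j + 1)) hpos hneg

theorem hasSum_dyadicBump {ρ : ℝ} (hρ : 0 < ρ) {x : E} (hx : x ≠ 0) :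
    HasSum (fun j : ℤ => dyadicBump ((ρ * 2 ^ j)⁻¹ • x)) 1 := by
  have hnorm : ∀ j : ℤ, ‖(ρ * 2 ^ j)⁻¹ • x‖ = ‖x‖ / ρ / 2 ^ j := fun j => by
    rw [norm_smul, norm_inv, norm_mul, norm_zpow, Real.norm_two, Real.norm_of_nonneg hρ.le]
    field_simp
  have hxρ : 0 < ‖x‖ / ρ := by positivity
  have hanti : Antitone fun j : ℤ => dyadicCutoff ((ρ * 2 ^ j)⁻¹ • x) := fun i j hij =>
    dyadicCutoff_mono (by rw [hnorm, hnorm]; gcongr; norm_num)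
  obtain ⟨n, hn, hn'⟩ := exists_mem_Ico_zpow hxρ (one_lt_two (α := ℝ))
  have htop : Tendsto (fun j : ℤ => dyadicCutoff ((ρ * 2 ^ j)⁻¹ • x)) atTop (𝓝 0) := by
    refine tendsto_const_nhds.congr' ?_
    filter_upwards [eventually_ge_atTop (n + 1)] with j hj
    refine (dyadicCutoff_eq_zero ?_).symm
    rw [hnorm, div_le_one (by positivity)]
    exact hn'.le.trans (zpow_le_zpow_right₀ one_le_two hj)
  have hbot : Tendsto (fun j : ℤ => dyadicCutoff ((ρ * 2 ^ j)⁻¹ • x)) atBot (𝓝 1) := by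
    refine tendsto_const_nhds.congr' ?_
    filter_upwards [eventually_le_atBot (n - 1)] with j hj
    refine (dyadicCutoff_eq_one ?_).symm
    rw [hnorm, le_div_iff₀ (by positivity), mul_comm, ← zpow_add_one₀ two_ne_zero]
    exact (zpow_le_zpow_right₀ one_le_two (by lia)).trans hn
  refine (sub_zero (1 : ℝ) ▸ hasSum_int_sub_of_antitone hanti htop hbot).congr_fun fun j => ?_
  rw [dyadicBump, smul_smul, zpow_add_one₀ two_ne_zero, ← mul_inv]
  ring_nf

end DyadicPartition

section RieszKernel

variable {E : Type*} [NormedAddCommGroup E] [InnerProductSpace ℝ E] {β : ℝ}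

theorem contDiff_norm_rpow_mul {φ : E → ℝ} (hφ : ContDiff ℝ ∞ φ) (h₀ : ∀ x, ‖x‖ ≤ 1 → φ x = 0)
    (p : ℝ) : ContDiff ℝ ∞ fun x => ‖x‖ ^ p * φ x := by
  refine contDiff_iff_contDiffAt.2 fun x => ?_
  rcases eq_or_ne x 0 with rfl | hx
  · refine (contDiffAt_const (c := 0)).congr_of_eventuallyEq ?_
    filter_upwards [Metric.closedBall_mem_nhds (0 : E) one_pos] with y hy
    rw [h₀ y (by simpa using hy), mul_zero]
  · exact (contDiffAt_norm ℝ hx).rpow_const_of_ne (norm_ne_zero_iff.2 hx) |>.mul hφ.contDiffAt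

/-- The part of the Riesz kernel `‖x‖ ^ (-β)` that lives at the unit scale. -/
noncomputable def dyadicKernel (β : ℝ) (x : E) : ℝ := ‖x‖ ^ (-β) * dyadicBump x

theorem contDiff_dyadicKernel (β : ℝ) : ContDiff ℝ ∞ (dyadicKernel β : E → ℝ) :=
  contDiff_norm_rpow_mul contDiff_dyadicBump (fun _ => dyadicBump_eq_zero_of_norm_le_one) _

theorem hasCompactSupport_dyadicKernel [FiniteDimensional ℝ E] (β : ℝ) :
    HasCompactSupport (dyadicKernel β : E → ℝ) :=
  hasCompactSupport_dyadicBump.mul_left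

theorem rescale_norm_rpow_mul (φ : E → ℝ) {s : ℝ} (hs : 0 < s) (x : E) :
    rescale β (fun x => ‖x‖ ^ (-β) * φ x) s x = ‖x‖ ^ (-β) * φ (s⁻¹ • x) := by
  rw [rescale, norm_smul, norm_inv, Real.norm_of_nonneg hs.le,
    Real.mul_rpow (by positivity) (norm_nonneg x), Real.inv_rpow hs.le, ← mul_assoc, ← mul_assoc,
    mul_inv_cancel₀ (by positivity), one_mul]

theorem hasSum_rescale_dyadicKernel (hβ : 0 < β) {ρ : ℝ} (hρ : 0 < ρ) (x : E) :
    HasSum (fun j : ℤ => rescale β (dyadicKernel β) (ρ * 2 ^ j) x) (‖x‖ ^ (-β)) := by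
  have hpiece : ∀ j : ℤ, rescale β (dyadicKernel β) (ρ * 2 ^ j) x =
      ‖x‖ ^ (-β) * dyadicBump ((ρ * 2 ^ j)⁻¹ • x) := fun j =>
    rescale_norm_rpow_mul dyadicBump (by positivity) x
  simp only [hpiece]
  rcases eq_or_ne x 0 with rfl | hx
  · simp [Real.zero_rpow (neg_ne_zero.2 hβ.ne')]
  · simpa using (hasSum_dyadicBump hρ hx).mul_left (‖x‖ ^ (-β))

theorem rescale_dyadicKernel_nonneg {s : ℝ} (hs : 0 < s) (x : E) :
    0 ≤ rescale β (dyadicKernel β) s x :=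
  mul_nonneg (by positivity) (mul_nonneg (by positivity) (dyadicBump_nonneg _))

variable [FiniteDimensional ℝ E] [MeasurableSpace E] [BorelSpace E]
  {V : Type*} [NormedAddCommGroup V] [NormedSpace ℝ V] {F : E → V}

theorem integrableOn_ball_norm_rpow_neg (hβ : 0 < β) (hβn : β < finrank ℝ E) :
    IntegrableOn (fun x : E => ‖x‖ ^ (-β)) (Metric.ball 0 1) := by
  have hn : 1 ≤ finrank ℝ E := by
    have : (0 : ℝ) < finrank ℝ E := hβ.trans hβn
    exact_mod_cast this
  refine integrableOn_ball_of_norm_le_rpow hn hβn (C := 1) (ae_of_all _ fun x => ?_) ?_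
  · rw [one_mul, Real.norm_of_nonneg (by positivity)]
  · exact (by fun_prop : Measurable fun x : E => ‖x‖ ^ (-β)).aestronglyMeasurable

theorem ae_convolutionExistsAt_norm_rpow_neg (hβ : 0 < β) (hβn : β < finrank ℝ E)
    (hF : Integrable F) :
    ∀ᵐ x, ConvolutionExistsAt (fun x => ‖x‖ ^ (-β)) F x (ContinuousLinearMap.lsmul ℝ ℝ) := by
  set k : E → ℝ := fun x => ‖x‖ ^ (-β)
  have hnear : Integrable ((Metric.ball 0 1).indicator k) :=
    (integrableOn_ball_norm_rpow_neg hβ hβn).integrable_indicator measurableSet_ball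
  have hfar : ∀ y, ‖(Metric.ball 0 1)ᶜ.indicator k y‖ ≤ 1 := by
    intro y
    rw [norm_indicator_eq_indicator_norm]
    refine indicator_apply_le' (fun hy => ?_) fun _ => zero_le_one
    rw [Real.norm_of_nonneg (by positivity)]
    exact Real.rpow_le_one_of_one_le_of_nonpos (by simpa using hy) (by linarith)
  have hk : Measurable k := by fun_prop
  filter_upwards [hnear.ae_convolution_exists (ContinuousLinearMap.lsmul ℝ ℝ) hF] with x hx
  have hx' := (hF.comp_sub_left x).bdd_smul 1
    (hk.indicator measurableSet_ball.compl).aestronglyMeasurable (ae_of_all _ hfar)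
  refine (hx.integrable.add hx').congr (ae_of_all _ fun y => ?_)
  simp only [Pi.add_apply, Pi.smul_apply', ContinuousLinearMap.lsmul_apply]
  rw [← add_smul, indicator_self_add_compl_apply]

theorem enorm_norm_rpow_neg_convolution_le_tsum (hβ : 0 < β) {ρ : ℝ} (hρ : 0 < ρ)
    (hF : AEStronglyMeasurable F) {x : E}
    (hx : ConvolutionExistsAt (fun x => ‖x‖ ^ (-β)) F x (ContinuousLinearMap.lsmul ℝ ℝ)) :
    ‖((fun x => ‖x‖ ^ (-β)) ⋆ F) x‖ₑ ≤
      ∑' j : ℤ, ‖(rescale β (dyadicKernel β) (ρ * 2 ^ j) ⋆ F) x‖ₑ := by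
  have hsum := fun y => hasSum_rescale_dyadicKernel hβ hρ (E := E) y
  have hmeas : ∀ j : ℤ, AEStronglyMeasurable
      fun y => rescale β (dyadicKernel β) (ρ * 2 ^ j) y • F (x - y) := fun j =>
    (continuous_rescale (contDiff_dyadicKernel β).continuous).aestronglyMeasurable.smul
      (hF.comp_measurePreserving (Measure.measurePreserving_sub_left volume x))
  refine enorm_integral_le_tsum hmeas ?_ (ae_of_all _ fun y => (hsum y).smul_const (F (x - y)))
  simp only [ContinuousLinearMap.lsmul_apply]
  rw [← lintegral_tsum fun j => (hmeas j).enorm]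
  refine (lt_of_le_of_lt (le_of_eq ?_) hx.2).ne
  refine lintegral_congr fun y => ?_
  have henorm : ∑' j : ℤ, ‖rescale β (dyadicKernel β) (ρ * 2 ^ j) y‖ₑ = ‖‖y‖ ^ (-β)‖ₑ := by
    rw [← (hsum y).tsum_eq]
    have hnonneg := fun j : ℤ => rescale_dyadicKernel_nonneg (β := β)
      (show (0 : ℝ) < ρ * 2 ^ j by positivity) y
    rw [Real.enorm_of_nonneg (tsum_nonneg hnonneg), ENNReal.ofReal_tsum_of_nonneg hnonneg
      (hsum y).summable]
    exact tsum_congr fun j => Real.enorm_of_nonneg (hnonneg j)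
  simp only [enorm_smul, ContinuousLinearMap.lsmul_apply]
  rw [ENNReal.tsum_mul_right, henorm]

end RieszKernel

/-! ### Riesz potentials of gradients -/

section OneScale

theorem summable_min_zpow_rpow {a b : ℝ} (ha : 0 < a) (hb : 0 < b) :
    Summable fun j : ℤ => min (((2 : ℝ) ^ j) ^ a) (((2 : ℝ) ^ j) ^ (-b)) := by
  have hgeom : ∀ c : ℝ, 0 < c → Summable fun n : ℕ => ((2 : ℝ) ^ (-c)) ^ n := fun c hc =>
    summable_geometric_of_lt_one (by positivity)
      (Real.rpow_lt_one_of_one_lt_of_neg one_lt_two (neg_lt_zero.2 hc))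
  have hpow : ∀ (j : ℤ) (c : ℝ), ((2 : ℝ) ^ j) ^ c = (2 ^ c) ^ j := fun j c => by
    rw [← Real.rpow_intCast, ← Real.rpow_mul two_pos.le, mul_comm, Real.rpow_mul two_pos.le,
      Real.rpow_intCast]
  refine Summable.of_nat_of_neg
    (Summable.of_nonneg_of_le (fun n => by positivity) (fun n => ?_) (hgeom b hb))
    (Summable.of_nonneg_of_le (fun n => by positivity) (fun n => ?_) (hgeom a ha))
  · exact (min_le_right _ _).trans_eq (by rw [hpow, zpow_natCast])
  · refine (min_le_left _ _).trans_eq ?_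
    rw [hpow, zpow_neg, zpow_natCast, Real.rpow_neg two_pos.le, inv_pow]

theorem rpow_one_sub_mul_rpow {θ : ℝ} (h₀ : 0 ≤ θ) (h₁ : θ ≤ 1) (M x y : ℝ≥0∞) :
    (M * x) ^ (1 - θ) * (M * y) ^ θ = M * (x ^ (1 - θ) * y ^ θ) := by
  rw [ENNReal.mul_rpow_of_nonneg _ _ (sub_nonneg.2 h₁), ENNReal.mul_rpow_of_nonneg _ _ h₀,
    mul_mul_mul_comm, ← ENNReal.rpow_add_of_nonneg _ _ (sub_nonneg.2 h₁) h₀, sub_add_cancel,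
    ENNReal.rpow_one]

variable {E : Type*} [NormedAddCommGroup E] [InnerProductSpace ℝ E] [FiniteDimensional ℝ E]
  [MeasurableSpace E] [BorelSpace E] {α : ℝ}

/-- A function `v` is adapted to the scale `ρ` with size `N` if it satisfies the bounds on `v` and
`∇ v` that a bump of height `N ρ ^ (1 - n)` on a ball of radius `ρ` would satisfy, where `n` is the
dimension. -/
structure IsAdapted (v : E → ℝ) (ρ : ℝ) (N : ℝ≥0∞) : Prop where
  contDiff : ContDiff ℝ 1 v
  hasCompactSupport : HasCompactSupport v
  lintegral_gradient_le : ∫⁻ x, ‖∇ v x‖ₑ ≤ N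
  enorm_le : ∀ x, ‖v x‖ₑ ≤ ENNReal.ofReal (ρ ^ (1 - finrank ℝ E : ℝ)) * N
  lintegral_le : ∫⁻ x, ‖v x‖ₑ ≤ ENNReal.ofReal ρ * N

theorem enorm_rescale_convolution_gradient_le {K : E → ℝ} (hK : ContDiff ℝ 1 K)
    (hcK : HasCompactSupport K) {M : ℝ≥0∞} (hM : ∫⁻ x, ‖∇ K x‖ₑ ≤ M) (hM' : ∀ x, ‖∇ K x‖ₑ ≤ M)
    {v : E → ℝ} {ρ : ℝ} {N : ℝ≥0∞} (hv : IsAdapted v ρ N) {s : ℝ} (hs : 0 < s) (x : E) :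
    ‖(rescale (finrank ℝ E - α) K s ⋆ ∇ v) x‖ₑ ≤ M * N *
      ENNReal.ofReal (min (s ^ (α - 1) * ρ ^ (1 - finrank ℝ E : ℝ))
        (s ^ (α - finrank ℝ E - 1) * ρ)) := by
  rw [convolution_gradient_comm (contDiff_rescale hK) (hasCompactSupport_rescale hcK hs.ne')
    hv.contDiff hv.hasCompactSupport, ENNReal.ofReal_min, mul_min]
  refine le_min ?_ ?_
  · calc _ ≤ (ENNReal.ofReal (ρ ^ (1 - finrank ℝ E : ℝ)) * N) *
          ∫⁻ y, ‖∇ (rescale (finrank ℝ E - α) K s) y‖ₑ :=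
          enorm_convolution_le_mul_lintegral hv.enorm_le
            (continuous_gradient (contDiff_rescale hK)).aestronglyMeasurable x
      _ ≤ (ENNReal.ofReal (ρ ^ (1 - finrank ℝ E : ℝ)) * N) *
          (ENNReal.ofReal (s ^ (α - 1)) * M) := by
          rw [lintegral_enorm_gradient_rescale volume _ K hs, sub_sub_cancel]
          gcongr
      _ = _ := by
          rw [ENNReal.ofReal_mul (by positivity)]
          ring
  · calc _ ≤ (∫⁻ y, ‖v y‖ₑ) * (ENNReal.ofReal (s ^ (α - finrank ℝ E - 1)) * M) := by
          refine enorm_convolution_le_lintegral_mul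
            hv.contDiff.continuous.aestronglyMeasurable (fun y => ?_) x
          rw [enorm_gradient_rescale _ K hs, neg_sub]
          gcongr
          exact hM' _
      _ ≤ (ENNReal.ofReal ρ * N) * (ENNReal.ofReal (s ^ (α - finrank ℝ E - 1)) * M) := by
          gcongr
          exact hv.lintegral_le
      _ = _ := by
          rw [ENNReal.ofReal_mul (by positivity)]
          ring

theorem rpow_one_sub_mul_min_rpow_le {n θ ρ r : ℝ} (hn : n * θ = α) (hθ : 0 ≤ θ) (hρ : 0 < ρ)
    (hr : 0 < r) :
    ((ρ * r) ^ α) ^ (1 - θ) *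
        (min ((ρ * r) ^ (α - 1) * ρ ^ (1 - n)) ((ρ * r) ^ (α - n - 1) * ρ)) ^ θ ≤
      min (r ^ (α - θ)) (r ^ (-θ)) := by
  have hs : 0 < ρ * r := mul_pos hρ hr
  have hpow : ∀ a b : ℝ, α * (1 - θ) + a * θ + b * θ = 0 →
      ((ρ * r) ^ α) ^ (1 - θ) * ((ρ * r) ^ a * ρ ^ b) ^ θ = r ^ (α * (1 - θ) + a * θ) := by
    intro a b hab
    rw [Real.mul_rpow (x := (ρ * r) ^ a) (by positivity) (by positivity), ← Real.rpow_mul hs.le,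
      ← Real.rpow_mul hs.le, ← Real.rpow_mul hρ.le, ← mul_assoc, ← Real.rpow_add hs,
      Real.mul_rpow hρ.le hr.le, mul_right_comm, ← Real.rpow_add hρ, hab, Real.rpow_zero, one_mul]
  refine le_min ?_ ?_
  · calc _ ≤ ((ρ * r) ^ α) ^ (1 - θ) * ((ρ * r) ^ (α - 1) * ρ ^ (1 - n)) ^ θ := by
          gcongr
          exact min_le_left _ _
      _ = r ^ (α * (1 - θ) + (α - 1) * θ) := hpow _ _ (by rw [← hn]; ring)
      _ = _ := by congr 1; ring
  · calc _ ≤ ((ρ * r) ^ α) ^ (1 - θ) * ((ρ * r) ^ (α - n - 1) * ρ ^ (1 : ℝ)) ^ θ := by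
          rw [Real.rpow_one]
          gcongr
          exact min_le_right _ _
      _ = r ^ (α * (1 - θ) + (α - n - 1) * θ) := hpow _ _ (by rw [← hn]; ring)
      _ = _ := by congr 1; rw [← hn]; ring

theorem interpNorm_rescale_convolution_gradient_le (hα₀ : 0 < α) (hαn : α < finrank ℝ E)
    {K : E → ℝ} (hK : ContDiff ℝ 1 K) (hcK : HasCompactSupport K) {M : ℝ≥0∞}
    (hM : ∫⁻ x, ‖K x‖ₑ ≤ M) (hM' : ∫⁻ x, ‖∇ K x‖ₑ ≤ M) (hM'' : ∀ x, ‖∇ K x‖ₑ ≤ M)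
    {v : E → ℝ} {ρ : ℝ} {N : ℝ≥0∞} (hv : IsAdapted v ρ N) (hρ : 0 < ρ) {θ : ℝ}
    (hθ : finrank ℝ E * θ = α) {r : ℝ} (hr : 0 < r) :
    interpNorm volume θ (rescale (finrank ℝ E - α) K (ρ * r) ⋆ ∇ v) ≤
      ENNReal.ofReal (1 / (1 - θ) + 1 / θ) *
        (M * N * ENNReal.ofReal (min (r ^ (α - θ)) (r ^ (-θ)))) := by
  have hn : (0 : ℝ) < finrank ℝ E := hα₀.trans hαn
  have hθ₀ : 0 < θ := pos_of_mul_pos_right (hθ.symm ▸ hα₀) hn.le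
  have hθ₁ : θ < 1 := by nlinarith
  have hs : 0 < ρ * r := mul_pos hρ hr
  set f := rescale (finrank ℝ E - α) K (ρ * r) ⋆ ∇ v
  have hL₁ : ∫⁻ x, ‖f x‖ₑ ≤ M * N * ENNReal.ofReal ((ρ * r) ^ α) := by
    calc _ ≤ (∫⁻ x, ‖rescale (finrank ℝ E - α) K (ρ * r) x‖ₑ) * ∫⁻ x, ‖∇ v x‖ₑ :=
          lintegral_enorm_convolution_le (contDiff_rescale hK).continuous.aestronglyMeasurable
            (continuous_gradient hv.contDiff).aestronglyMeasurable
      _ ≤ (ENNReal.ofReal ((ρ * r) ^ α) * M) * N := by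
          rw [lintegral_enorm_rescale volume _ K hs, sub_sub_cancel]
          gcongr
          exact hv.lintegral_gradient_le
      _ = _ := by ring
  have hsup := eLpNormEssSup_le_of_ae_enorm_bound (μ := volume) <| ae_of_all _ fun x =>
    enorm_rescale_convolution_gradient_le (α := α) hK hcK hM' hM'' hv hs x
  refine (interpNorm_le_rpow_mul_rpow hθ₀ hθ₁ f).trans (mul_le_mul_right ?_ _)
  calc _ ≤ _ := mul_le_mul' (ENNReal.rpow_le_rpow hL₁ (sub_nonneg.2 hθ₁.le))
        (ENNReal.rpow_le_rpow hsup hθ₀.le)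
    _ = M * N * ENNReal.ofReal (((ρ * r) ^ α) ^ (1 - θ) *
        (min ((ρ * r) ^ (α - 1) * ρ ^ (1 - finrank ℝ E : ℝ))
          ((ρ * r) ^ (α - finrank ℝ E - 1) * ρ)) ^ θ) := by
        rw [rpow_one_sub_mul_rpow hθ₀.le hθ₁.le,
          ENNReal.ofReal_rpow_of_nonneg (by positivity) (sub_nonneg.2 hθ₁.le),
          ENNReal.ofReal_rpow_of_nonneg (by positivity) hθ₀.le,
          ENNReal.ofReal_mul (by positivity)]
    _ ≤ _ := by
        gcongr
        exact rpow_one_sub_mul_min_rpow_le hθ hθ₀.le hρ hr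

theorem exists_enorm_gradient_le_of_hasCompactSupport {K : E → ℝ} (hK : ContDiff ℝ 1 K)
    (hcK : HasCompactSupport K) :
    ∃ M : ℝ≥0, ∫⁻ x, ‖K x‖ₑ ≤ M ∧ ∫⁻ x, ‖∇ K x‖ₑ ≤ M ∧ ∀ x, ‖∇ K x‖ₑ ≤ M := by
  obtain ⟨B, hB⟩ := (hasCompactSupport_gradient hcK).exists_bound_of_continuous
    (continuous_gradient hK)
  let M : ℝ≥0∞ := max (max (∫⁻ x, ‖K x‖ₑ) (∫⁻ x, ‖∇ K x‖ₑ)) (ENNReal.ofReal B)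
  have hM : M ≠ ⊤ := (max_lt (max_lt (hK.continuous.integrable_of_hasCompactSupport hcK).2
    (integrable_gradient hK hcK).2) ENNReal.ofReal_lt_top).ne
  refine ⟨M.toNNReal, ?_⟩
  rw [ENNReal.coe_toNNReal hM]
  refine ⟨(le_max_left _ _).trans (le_max_left _ _), (le_max_right _ _).trans (le_max_left _ _),
    fun x => le_trans ?_ (le_max_right _ _)⟩
  rw [← ofReal_norm]
  exact ENNReal.ofReal_le_ofReal (hB x)

theorem exists_interpNorm_convolution_gradient_le_of_isAdapted (hn : 1 < finrank ℝ E)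
    (hα₀ : 0 < α) (hαn : α < finrank ℝ E) :
    ∃ C : ℝ≥0, ∀ (v : E → ℝ) (ρ : ℝ) (N : ℝ≥0∞), IsAdapted v ρ N → 0 < ρ →
      interpNorm volume (α / finrank ℝ E) ((fun x => ‖x‖ ^ (-(finrank ℝ E - α))) ⋆ ∇ v) ≤
        C * N := by
  set θ := α / finrank ℝ E
  have hn₁ : (1 : ℝ) < finrank ℝ E := by exact_mod_cast hn
  have hθ₀ : 0 < θ := div_pos hα₀ (by linarith)
  have hθα : θ < α := div_lt_self hα₀ hn₁
  have hK : ContDiff ℝ 1 (dyadicKernel (finrank ℝ E - α) : E → ℝ) :=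
    (contDiff_dyadicKernel _).of_le (by exact_mod_cast le_top)
  have hcK := hasCompactSupport_dyadicKernel (E := E) (finrank ℝ E - α)
  obtain ⟨M, hM, hM', hM''⟩ := exists_enorm_gradient_le_of_hasCompactSupport hK hcK
  have hS := (summable_min_zpow_rpow (sub_pos.2 hθα) hθ₀).tsum_ofReal_ne_top
  lift ∑' j : ℤ, ENNReal.ofReal (min (((2 : ℝ) ^ j) ^ (α - θ)) (((2 : ℝ) ^ j) ^ (-θ))) to ℝ≥0
    using hS with S hS'
  refine ⟨(1 / (1 - θ) + 1 / θ).toNNReal * M * S, fun v ρ N hv hρ => ?_⟩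
  calc _ ≤ ∑' j : ℤ, interpNorm volume θ
        (rescale (finrank ℝ E - α) (dyadicKernel (finrank ℝ E - α)) (ρ * 2 ^ j) ⋆ ∇ v) := by
        refine interpNorm_le_tsum (fun j => aestronglyMeasurable_convolution
          (contDiff_rescale hK).continuous.aestronglyMeasurable
          (continuous_gradient hv.contDiff).aestronglyMeasurable) ?_
        filter_upwards [ae_convolutionExistsAt_norm_rpow_neg (sub_pos.2 hαn) (by linarith)
          (integrable_gradient hv.contDiff hv.hasCompactSupport)] with x hx
        exact enorm_norm_rpow_neg_convolution_le_tsum (sub_pos.2 hαn) hρ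
          (continuous_gradient hv.contDiff).aestronglyMeasurable hx
    _ ≤ ∑' j : ℤ, ENNReal.ofReal (1 / (1 - θ) + 1 / θ) * (M * N *
        ENNReal.ofReal (min (((2 : ℝ) ^ j) ^ (α - θ)) (((2 : ℝ) ^ j) ^ (-θ)))) := by
        exact ENNReal.tsum_le_tsum fun j => interpNorm_rescale_convolution_gradient_le hα₀ hαn hK
          hcK hM hM' hM'' hv hρ (mul_div_cancel₀ α (by linarith)) (by positivity)
    _ = _ := by
        rw [ENNReal.tsum_mul_left, ENNReal.tsum_mul_left, ← hS', ENNReal.ofReal]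
        push_cast
        ring

end OneScale

section LevelProfile

/-- The odd primitive of `dyadicBump` on the line; the functions `2 ^ j * levelProfile (2 ^ (-j) s)`
cut the identity `s ↦ s` into pieces of height comparable to `2 ^ j`. -/
noncomputable def levelProfile (s : ℝ) : ℝ := ∫ t in (0 : ℝ)..s, dyadicBump t

theorem hasDerivAt_levelProfile (s : ℝ) : HasDerivAt levelProfile (dyadicBump s) s :=
  (contDiff_dyadicBump.continuous (E := ℝ)).integral_hasStrictDerivAt 0 s |>.hasDerivAt

theorem contDiff_levelProfile : ContDiff ℝ 1 levelProfile := by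
  refine contDiff_one_iff_deriv.2 ⟨fun s => (hasDerivAt_levelProfile s).differentiableAt, ?_⟩
  rw [funext fun s => (hasDerivAt_levelProfile s).deriv]
  exact contDiff_dyadicBump.continuous

theorem monotone_levelProfile : Monotone levelProfile :=
  monotone_of_hasDerivAt_nonneg hasDerivAt_levelProfile dyadicBump_nonneg

theorem levelProfile_zero : levelProfile 0 = 0 := intervalIntegral.integral_same

theorem levelProfile_neg (s : ℝ) : levelProfile (-s) = -levelProfile s := by
  have heven : ∀ t : ℝ, dyadicBump (-t) = dyadicBump t := fun t => by
    simp only [dyadicBump, dyadicCutoff, smul_neg, norm_neg]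
  have h := intervalIntegral.integral_comp_neg (a := 0) (b := s) (dyadicBump : ℝ → ℝ)
  simp only [heven, neg_zero] at h
  rw [levelProfile, levelProfile, h, intervalIntegral.integral_symm]

theorem abs_levelProfile (s : ℝ) : |levelProfile s| = levelProfile |s| := by
  have hnonneg : ∀ {t : ℝ}, 0 ≤ t → |levelProfile t| = levelProfile t := fun ht =>
    abs_of_nonneg (levelProfile_zero.symm.trans_le (monotone_levelProfile ht))
  rcases abs_cases s with ⟨h, hs⟩ | ⟨h, hs⟩
  · rw [h, hnonneg hs]
  · rw [h, ← hnonneg (neg_pos.2 hs).le, levelProfile_neg, abs_neg]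

theorem levelProfile_eq_zero {s : ℝ} (hs : |s| ≤ 1) : levelProfile s = 0 := by
  rw [← abs_eq_zero, abs_levelProfile, levelProfile]
  refine intervalIntegral.integral_zero_ae (ae_of_all _ fun t ht => ?_)
  rw [uIoc_of_le (abs_nonneg s)] at ht
  exact dyadicBump_eq_zero_of_norm_le_one ((abs_of_pos ht.1).trans_le (ht.2.trans hs))

theorem levelProfile_of_four_le {s : ℝ} (hs : 4 ≤ s) : levelProfile s = levelProfile 4 := by
  have hint : ∀ a b : ℝ, IntervalIntegrable dyadicBump volume a b :=
    (contDiff_dyadicBump.continuous (E := ℝ)).intervalIntegrable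
  rw [levelProfile, ← intervalIntegral.integral_add_adjacent_intervals (hint 0 4) (hint 4 s),
    ← levelProfile, add_eq_left]
  refine intervalIntegral.integral_zero_ae (ae_of_all _ fun t ht => ?_)
  rw [uIoc_of_le hs] at ht
  exact dyadicBump_eq_zero_of_four_le_norm (ht.1.le.trans (le_abs_self t))

theorem abs_levelProfile_of_four_le {s : ℝ} (hs : 4 ≤ |s|) : |levelProfile s| = levelProfile 4 := by
  rw [abs_levelProfile, levelProfile_of_four_le hs]

theorem abs_levelProfile_le (s : ℝ) : |levelProfile s| ≤ levelProfile 4 := by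
  rw [abs_levelProfile, ← levelProfile_of_four_le (le_max_right |s| 4)]
  exact monotone_levelProfile (le_max_left _ _)

theorem levelProfile_four_pos : 0 < levelProfile 4 := by
  have htwo : dyadicBump (2 : ℝ) = 1 := by
    rw [dyadicBump, dyadicCutoff_eq_one (by norm_num), dyadicCutoff_eq_zero (by norm_num),
      sub_zero]
  exact intervalIntegral.integral_pos (by norm_num) contDiff_dyadicBump.continuous.continuousOn
    (fun t _ => dyadicBump_nonneg t) ⟨2, by norm_num, htwo ▸ one_pos⟩

end LevelProfile

section LevelPieces

/-- The part of `u` that varies where `|u|` is comparable to `2 ^ j`. -/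
noncomputable def levelPiece {X : Type*} (u : X → ℝ) (j : ℤ) : X → ℝ :=
  (fun s => 2 ^ j * levelProfile ((2 ^ j)⁻¹ * s)) ∘ u

section Basic

variable {X : Type*} {u : X → ℝ} {j : ℤ}

theorem levelPiece_eq_zero {x : X} (hx : |u x| ≤ 2 ^ j) : levelPiece u j x = 0 := by
  have h : |((2 : ℝ) ^ j)⁻¹ * u x| ≤ 1 := by
    rw [abs_mul, abs_of_pos (by positivity), inv_mul_le_one₀ (by positivity)]
    exact hx
  rw [levelPiece, Function.comp_apply, levelProfile_eq_zero h, mul_zero]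

theorem hasCompactSupport_levelPiece [TopologicalSpace X] [T2Space X]
    (hu : Tendsto u (cocompact X) (𝓝 0)) (j : ℤ) :
    HasCompactSupport (levelPiece u j) := by
  rw [hasCompactSupport_iff_eventuallyEq, coclosedCompact_eq_cocompact]
  filter_upwards [hu (Metric.ball_mem_nhds 0 (show (0 : ℝ) < 2 ^ j by positivity))] with x hx
  exact levelPiece_eq_zero (by simpa using (mem_ball_zero_iff.1 hx).le)

theorem abs_levelPiece (j : ℤ) (x : X) :
    |levelPiece u j x| = 2 ^ j * |levelProfile ((2 ^ j)⁻¹ * u x)| := by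
  rw [levelPiece, Function.comp_apply, abs_mul, abs_of_pos (by positivity)]

theorem abs_levelPiece_le (j : ℤ) (x : X) : |levelPiece u j x| ≤ 2 ^ j * levelProfile 4 := by
  rw [abs_levelPiece]
  gcongr
  exact abs_levelProfile_le _

/-- The next but one lower piece has reached its maximal height on the support of a given one, so
its superlevel sets control that support. -/
theorem support_levelPiece_subset (j : ℤ) :
    Function.support (levelPiece u j) ⊆
      {x | 2 ^ (j - 2) * levelProfile 4 ≤ |levelPiece u (j - 2) x|} := by
  intro x hx
  have hux : (2 : ℝ) ^ j < |u x| := not_le.1 fun h => hx (levelPiece_eq_zero h)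
  refine (Eq.le ?_ : _ ≤ |levelPiece u (j - 2) x|)
  rw [abs_levelPiece, abs_levelProfile_of_four_le]
  rw [abs_mul, abs_of_pos (by positivity), le_inv_mul_iff₀ (by positivity)]
  refine le_trans (le_of_eq ?_) hux.le
  rw [zpow_sub₀ two_ne_zero]
  norm_num

end Basic

variable {E : Type*} [NormedAddCommGroup E] [InnerProductSpace ℝ E] {u : E → ℝ}

theorem contDiff_levelPiece (hu : ContDiff ℝ 1 u) (j : ℤ) : ContDiff ℝ 1 (levelPiece u j) :=
  (contDiff_const.mul (contDiff_levelProfile.comp (contDiff_const.mul contDiff_id))).comp hu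

theorem gradient_levelPiece [CompleteSpace E] (hu : ContDiff ℝ 1 u) (j : ℤ) (x : E) :
    ∇ (levelPiece u j) x = dyadicBump (((2 : ℝ) ^ j)⁻¹ • u x) • ∇ u x := by
  refine gradient_comp ?_ (hu.differentiable one_ne_zero x)
  have hinner : HasDerivAt (fun s => (2 ^ j)⁻¹ * s) ((2 : ℝ) ^ j)⁻¹ (u x) := by
    simpa only [mul_one, id] using (hasDerivAt_id (u x)).const_mul ((2 : ℝ) ^ j)⁻¹
  refine (((hasDerivAt_levelProfile _).comp (u x) hinner).const_mul ((2 : ℝ) ^ j)).congr_deriv ?_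
  rw [mul_left_comm, mul_inv_cancel₀ (by positivity), mul_one, smul_eq_mul]

variable [FiniteDimensional ℝ E] [MeasurableSpace E] [BorelSpace E]

theorem gradient_ae_eq_zero (hu : ContDiff ℝ 1 u) : ∀ᵐ x, u x = 0 → ∇ u x = 0 := by
  rcases subsingleton_or_nontrivial E with _ | _
  · exact ae_of_all _ fun x _ => Subsingleton.elim _ _
  obtain ⟨e, he⟩ := exists_ne (0 : E)
  have hs : MeasurableSet {x | u x = 0} := hu.continuous.measurable (measurableSet_singleton 0)
  have happrox : ApproximatesLinearOn (fun x => u x • e) (0 : E →L[ℝ] E) {x | u x = 0} 0 := by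
    intro x (hx : u x = 0) y (hy : u y = 0)
    simp [hx, hy]
  have hderiv : ∀ x, HasFDerivAt (fun x => u x • e) ((fderiv ℝ u x).smulRight e) x := fun x =>
    (hu.differentiable one_ne_zero x).hasFDerivAt.smul_const e
  have h := happrox.norm_fderiv_sub_le volume hs _ fun x _ => (hderiv x).hasFDerivWithinAt
  filter_upwards [(ae_restrict_iff' hs).1 h] with x hx hux
  have hzero : ‖fderiv ℝ u x‖ * ‖e‖ = 0 := by
    rw [← ContinuousLinearMap.norm_smulRight_apply, ← coe_nnnorm, NNReal.coe_eq_zero]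
    simpa using hx hux
  rw [← norm_eq_zero, norm_gradient]
  exact (mul_eq_zero.1 hzero).resolve_right (norm_ne_zero_iff.2 he)

theorem hasSum_gradient_levelPiece (hu : ContDiff ℝ 1 u) :
    ∀ᵐ x, HasSum (fun j : ℤ => ∇ (levelPiece u j) x) (∇ u x) := by
  filter_upwards [gradient_ae_eq_zero hu] with x hx
  simp only [gradient_levelPiece hu]
  by_cases hux : u x = 0
  · simpa only [hx hux, smul_zero] using hasSum_zero
  · simpa only [one_mul, one_smul] using (hasSum_dyadicBump one_pos hux).smul_const (∇ u x)

theorem tsum_lintegral_gradient_levelPiece_le (hu : ContDiff ℝ 1 u) :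
    ∑' j : ℤ, ∫⁻ x, ‖∇ (levelPiece u j) x‖ₑ ≤ ∫⁻ x, ‖∇ u x‖ₑ := by
  rw [← lintegral_tsum fun j =>
    (continuous_gradient (contDiff_levelPiece hu j)).enorm.measurable.aemeasurable]
  refine lintegral_mono fun x => ?_
  by_cases hux : u x = 0
  · simp [gradient_levelPiece hu, hux, dyadicBump_eq_zero_of_norm_le_one]
  have hsum := hasSum_dyadicBump one_pos hux
  simp only [one_mul] at hsum
  simp_rw [gradient_levelPiece hu, enorm_smul, Real.enorm_of_nonneg (dyadicBump_nonneg _)]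
  rw [ENNReal.tsum_mul_right, ← ENNReal.ofReal_tsum_of_nonneg (fun j => dyadicBump_nonneg _)
    hsum.summable, hsum.tsum_eq, ENNReal.ofReal_one, one_mul]

end LevelPieces

section Series

variable {E : Type*} [NormedAddCommGroup E] [InnerProductSpace ℝ E] [FiniteDimensional ℝ E]
  [MeasurableSpace E] [BorelSpace E] {V : Type*} [NormedAddCommGroup V] [NormedSpace ℝ V]
  {ι : Type*} [Countable ι] {f : ι → E → V} {g : E → V} {β : ℝ}

theorem ae_tsum_lintegral_norm_rpow_neg_smul_ne_top (hβ : 0 < β) (hβn : β < finrank ℝ E)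
    (hf : ∀ i, AEStronglyMeasurable (f i)) (hsum : ∑' i, ∫⁻ y, ‖f i y‖ₑ ≠ ⊤) :
    ∀ᵐ x : E, ∑' i, ∫⁻ t : E, ‖‖t‖ ^ (-β) • f i (x - t)‖ₑ ≠ ⊤ := by
  set H : E → ℝ≥0∞ := fun y => ∑' i, ‖f i y‖ₑ with hH
  have hH_meas : AEMeasurable H := AEMeasurable.tsum fun i => (hf i).enorm
  have hH_int : ∫⁻ y, H y ≠ ⊤ := by rwa [lintegral_tsum fun i => (hf i).enorm]
  have hkernel : AEMeasurable fun t : E => ‖‖t‖ ^ (-β)‖ₑ :=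
    (measurable_norm.pow_const _).enorm.aemeasurable
  filter_upwards [ae_convolutionExistsAt_norm_rpow_neg hβ hβn
    (integrable_toReal_of_lintegral_ne_top hH_meas hH_int)] with x hx
  have hpres := quasiMeasurePreserving_sub_left (volume : Measure E) x
  calc ∑' i, ∫⁻ t : E, ‖‖t‖ ^ (-β) • f i (x - t)‖ₑ
      = ∫⁻ t : E, ‖‖t‖ ^ (-β)‖ₑ * H (x - t) := by
        simp only [enorm_smul, hH, ← ENNReal.tsum_mul_left]
        exact (lintegral_tsum fun i =>
          hkernel.mul ((hf i).enorm.comp_quasiMeasurePreserving hpres)).symm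
    _ = ∫⁻ t : E, ‖‖t‖ ^ (-β) • (H (x - t)).toReal‖ₑ := by
        refine lintegral_congr_ae ?_
        filter_upwards [hpres.ae (ae_lt_top' hH_meas hH_int)] with t ht
        rw [enorm_smul, Real.enorm_of_nonneg ENNReal.toReal_nonneg, ENNReal.ofReal_toReal ht.ne]
    _ ≠ ⊤ := hx.2.ne

theorem interpNorm_norm_rpow_neg_convolution_le_tsum (hβ : 0 < β) (hβn : β < finrank ℝ E)
    (hf : ∀ i, AEStronglyMeasurable (f i)) (hsum : ∑' i, ∫⁻ y, ‖f i y‖ₑ ≠ ⊤)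
    (hfg : ∀ᵐ y, HasSum (fun i => f i y) (g y)) {θ : ℝ} :
    interpNorm volume θ ((fun x => ‖x‖ ^ (-β)) ⋆ g) ≤
      ∑' i, interpNorm volume θ ((fun x => ‖x‖ ^ (-β)) ⋆ f i) := by
  have hkernel : AEStronglyMeasurable fun x : E => ‖x‖ ^ (-β) :=
    (measurable_norm.pow_const _).aestronglyMeasurable
  refine interpNorm_le_tsum (fun i => aestronglyMeasurable_convolution hkernel (hf i)) ?_
  filter_upwards [ae_tsum_lintegral_norm_rpow_neg_smul_ne_top hβ hβn hf hsum] with x hx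
  have hpres := quasiMeasurePreserving_sub_left (volume : Measure E) x
  refine enorm_integral_le_tsum
    (fun i => hkernel.smul ((hf i).comp_quasiMeasurePreserving hpres)) hx ?_
  filter_upwards [hpres.ae hfg] with t ht
  exact ht.const_smul _

end Series

section GradientEstimate

variable {E : Type*} [NormedAddCommGroup E] [InnerProductSpace ℝ E] [FiniteDimensional ℝ E]
  [MeasurableSpace E] [BorelSpace E] {α : ℝ}

theorem exists_volume_abs_ge_le_lintegral_gradient (hn : 1 < finrank ℝ E) :
    ∃ c : ℝ≥0, ∀ (v : E → ℝ) (τ : ℝ), ContDiff ℝ 1 v → HasCompactSupport v → 0 < τ →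
      volume {x | τ ≤ |v x|} ≤
        (c * (∫⁻ x, ‖∇ v x‖ₑ) / ENNReal.ofReal τ) ^ (finrank ℝ E / (finrank ℝ E - 1) : ℝ) := by
  have hn' : (1 : ℝ) < finrank ℝ E := by exact_mod_cast hn
  set p : ℝ := finrank ℝ E / (finrank ℝ E - 1)
  have hp : 0 < p := div_pos (by linarith) (by linarith)
  have hconj : NNReal.HolderConjugate (finrank ℝ E : ℝ≥0) p.toNNReal := by
    rw [← NNReal.holderConjugate_coe_iff, Real.coe_toNNReal _ hp.le]
    exact Real.HolderConjugate.conjExponent hn'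
  refine ⟨eLpNormLESNormFDerivOneConst (volume : Measure E) p.toNNReal, fun v τ hv hcv hτ => ?_⟩
  have hGNS := eLpNorm_le_eLpNorm_fderiv_one volume hv hcv hconj
  simp_rw [eLpNorm_one_eq_lintegral_enorm, ← enorm_gradient] at hGNS
  have hMarkov := meas_ge_le_mul_pow_eLpNorm_enorm volume (p := ENNReal.ofReal p)
    (by simpa using hp) ENNReal.ofReal_ne_top hv.continuous.aestronglyMeasurable
    (ε := ENNReal.ofReal τ) (by simpa using hτ) (by simp)
  rw [ENNReal.toReal_ofReal hp.le, ← ENNReal.mul_rpow_of_nonneg _ _ hp.le] at hMarkov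
  have hset : {x | τ ≤ |v x|} = {x | ENNReal.ofReal τ ≤ ‖v x‖ₑ} := by
    ext x
    rw [mem_ofPred_eq, mem_ofPred_eq, ← ofReal_norm,
      ENNReal.ofReal_le_ofReal_iff (norm_nonneg _), Real.norm_eq_abs]
  rw [hset, ENNReal.div_eq_inv_mul]
  exact hMarkov.trans (by gcongr; exact hGNS)

theorem lintegral_enorm_le_mul_measure_support {X G : Type*} [MeasurableSpace X]
    [NormedAddCommGroup G] {μ : Measure X} {f : X → G} {b : ℝ≥0∞} (hb : ∀ x, ‖f x‖ₑ ≤ b) :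
    ∫⁻ x, ‖f x‖ₑ ∂μ ≤ b * μ (Function.support f) := by
  calc ∫⁻ x, ‖f x‖ₑ ∂μ = ∫⁻ x in Function.support f, ‖f x‖ₑ ∂μ :=
        (setLIntegral_eq_of_support_subset fun x hx => by simpa using hx).symm
    _ ≤ b * μ (Function.support f) := (lintegral_mono hb).trans_eq (setLIntegral_const _ _)

theorem isAdapted_of_volume_support_le (hn : 1 < finrank ℝ E) {v : E → ℝ} (hv : ContDiff ℝ 1 v)
    (hcv : HasCompactSupport v) {B c a N : ℝ≥0} (ha : 0 < a) (hN : 0 < N)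
    (hgrad : ∫⁻ x, ‖∇ v x‖ₑ ≤ N) (hB : ∀ x, ‖v x‖ₑ ≤ B * a)
    (hvol : volume (Function.support v) ≤
      (c * N / a : ℝ≥0∞) ^ (finrank ℝ E / (finrank ℝ E - 1) : ℝ)) :
    IsAdapted v ((N / a) ^ (1 / (finrank ℝ E - 1) : ℝ) : ℝ≥0)
      ((1 + B + B * c ^ (finrank ℝ E / (finrank ℝ E - 1) : ℝ) : ℝ≥0) * N) := by
  have hn' : (0 : ℝ) < finrank ℝ E - 1 := sub_pos.2 (by exact_mod_cast hn)
  set n : ℝ := (finrank ℝ E : ℝ)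
  set ρ : ℝ≥0 := (N / a) ^ (1 / (n - 1))
  set A : ℝ≥0 := 1 + B + B * c ^ (n / (n - 1))
  have hA : 1 ≤ A := by simp only [A, add_assoc, le_add_iff_nonneg_right, zero_le]
  have hheight : ρ ^ (1 - n) * N = a := by
    rw [← NNReal.rpow_mul, show 1 / (n - 1) * (1 - n) = -1 by field_simp; ring,
      NNReal.rpow_neg_one, inv_div, div_mul_cancel₀ _ hN.ne']
  have hvolume : a * (N / a) ^ (n / (n - 1)) = ρ * N := by
    rw [show n / (n - 1) = 1 + 1 / (n - 1) by field_simp; ring,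
      NNReal.rpow_add (by positivity), NNReal.rpow_one, ← mul_assoc, mul_div_cancel₀ _ ha.ne',
      mul_comm]
  refine ⟨hv, hcv, hgrad.trans ?_, fun x => (hB x).trans ?_, ?_⟩
  · exact_mod_cast le_mul_of_one_le_left zero_le hA
  · rw [← NNReal.coe_rpow, ENNReal.ofReal_coe_nnreal, ← ENNReal.coe_mul B, ← ENNReal.coe_mul A,
      ← ENNReal.coe_mul, ENNReal.coe_le_coe, mul_left_comm, hheight]
    gcongr
    exact le_add_right le_add_self
  · rw [ENNReal.ofReal_coe_nnreal]
    calc ∫⁻ x, ‖v x‖ₑ ≤ B * a * volume (Function.support v) :=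
          lintegral_enorm_le_mul_measure_support hB
      _ ≤ B * a * (c * N / a : ℝ≥0∞) ^ (n / (n - 1)) := by gcongr
      _ = (B * c ^ (n / (n - 1)) * (a * (N / a) ^ (n / (n - 1))) : ℝ≥0) := by
          rw [← ENNReal.coe_mul c, ← ENNReal.coe_div ha.ne',
            ← ENNReal.coe_rpow_of_nonneg _ (by positivity), mul_div_assoc, NNReal.mul_rpow]
          push_cast
          ring
      _ ≤ ρ * (A * N) := by
          rw [hvolume]
          norm_cast
          rw [mul_left_comm]
          gcongr
          exact le_add_self

theorem exists_isAdapted_levelPiece (hn : 1 < finrank ℝ E) :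
    ∃ A : ℝ≥0, ∀ (u : E → ℝ) (j : ℤ) (N : ℝ≥0), ContDiff ℝ 1 u → Tendsto u (cocompact E) (𝓝 0) →
      0 < N → (∫⁻ x, ‖∇ (levelPiece u j) x‖ₑ) + ∫⁻ x, ‖∇ (levelPiece u (j - 2)) x‖ₑ ≤ N →
      ∃ ρ : ℝ, 0 < ρ ∧ IsAdapted (levelPiece u j) ρ (A * N) := by
  obtain ⟨c, hGNS⟩ := exists_volume_abs_ge_le_lintegral_gradient (E := E) hn
  obtain ⟨κ, hκ⟩ : ∃ κ : ℝ≥0, κ = levelProfile 4 := ⟨⟨_, levelProfile_four_pos.le⟩, rfl⟩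
  have hκ_pos : 0 < κ := by exact_mod_cast hκ ▸ levelProfile_four_pos
  refine ⟨_, fun u j N hu hu₀ hN hgrad => ⟨_, ?_, isAdapted_of_volume_support_le hn
    (contDiff_levelPiece hu j) (hasCompactSupport_levelPiece hu₀ j) (a := 2 ^ j) (B := κ)
    (c := 4 * c / κ) (by positivity) hN (le_self_add.trans hgrad) (fun x => ?_) ?_⟩⟩
  · exact NNReal.coe_pos.2 (by positivity)
  · rw [← ofReal_norm, Real.norm_eq_abs, ← ENNReal.coe_mul, ← ENNReal.ofReal_coe_nnreal]
    push_cast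
    rw [hκ, mul_comm]
    exact ENNReal.ofReal_le_ofReal (abs_levelPiece_le j x)
  · have hτ : ENNReal.ofReal (2 ^ (j - 2) * levelProfile 4) = (2 ^ (j - 2) * κ : ℝ≥0) := by
      rw [← hκ, ← ENNReal.ofReal_coe_nnreal]
      push_cast
      rfl
    have hlevel : c * N / (2 ^ (j - 2) * κ) = 4 * c / κ * N / 2 ^ j := by
      rw [zpow_sub₀ two_ne_zero]
      field_simp
      norm_num
    calc volume (Function.support (levelPiece u j))
        ≤ _ := measure_mono (support_levelPiece_subset j)
      _ ≤ _ := hGNS _ _ (contDiff_levelPiece hu _) (hasCompactSupport_levelPiece hu₀ _)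
          (mul_pos (by positivity) levelProfile_four_pos)
      _ ≤ (c * N / (2 ^ (j - 2) * κ : ℝ≥0) : ℝ≥0∞) ^
          (finrank ℝ E / (finrank ℝ E - 1) : ℝ) := by
          rw [hτ]
          gcongr
          · exact div_nonneg (Nat.cast_nonneg _) (sub_nonneg.2 (by exact_mod_cast hn.le))
          · exact le_add_self.trans hgrad
      _ = _ := by
          rw [← ENNReal.coe_mul, ← ENNReal.coe_div (by positivity), hlevel,
            ENNReal.coe_div (by positivity), ENNReal.coe_mul]

theorem exists_interpNorm_convolution_gradient_levelPiece_le (hn : 1 < finrank ℝ E) (hα₀ : 0 < α)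
    (hαn : α < finrank ℝ E) :
    ∃ C : ℝ≥0, ∀ (u : E → ℝ) (j : ℤ), ContDiff ℝ 1 u → Tendsto u (cocompact E) (𝓝 0) →
      interpNorm volume (α / finrank ℝ E)
          ((fun x => ‖x‖ ^ (-(finrank ℝ E - α))) ⋆ ∇ (levelPiece u j)) ≤
        C * ((∫⁻ x, ‖∇ (levelPiece u j) x‖ₑ) + ∫⁻ x, ‖∇ (levelPiece u (j - 2)) x‖ₑ) := by
  obtain ⟨A, hA⟩ := exists_isAdapted_levelPiece (E := E) hn
  obtain ⟨C, hC⟩ := exists_interpNorm_convolution_gradient_le_of_isAdapted (E := E) hn hα₀ hαn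
  refine ⟨C * A + 1, fun u j hu hu₀ => ENNReal.le_mul_of_forall_lt
    (.inl (by exact_mod_cast (by positivity : C * A + 1 ≠ 0))) (.inl ENNReal.coe_ne_top)
    fun M hM N hN => ?_⟩
  rcases eq_or_ne N ⊤ with rfl | hN_top
  · rw [ENNReal.mul_top (pos_of_gt hM).ne']
    exact le_top
  lift N to ℝ≥0 using hN_top
  obtain ⟨ρ, hρ, hv⟩ := hA u j N hu hu₀ (by exact_mod_cast pos_of_gt hN) hN.le
  refine (hC _ ρ _ hv hρ).trans ?_
  rw [← mul_assoc, ← ENNReal.coe_mul]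
  gcongr
  exact (by exact_mod_cast le_self_add : ((C * A : ℝ≥0) : ℝ≥0∞) ≤ (C * A + 1 : ℝ≥0)).trans hM.le

theorem exists_interpNorm_convolution_gradient_le (hn : 1 < finrank ℝ E) (hα₀ : 0 < α)
    (hαn : α < finrank ℝ E) :
    ∃ C : ℝ≥0, ∀ u : E → ℝ, ContDiff ℝ 1 u → Tendsto u (cocompact E) (𝓝 0) →
      Integrable (∇ u) →
      interpNorm volume (α / finrank ℝ E) ((fun x => ‖x‖ ^ (-(finrank ℝ E - α))) ⋆ ∇ u) ≤
        C * ∫⁻ x, ‖∇ u x‖ₑ := by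
  obtain ⟨C, hC⟩ := exists_interpNorm_convolution_gradient_levelPiece_le (E := E) hn hα₀ hαn
  refine ⟨C * 2, fun u hu hu₀ hint => ?_⟩
  have hpieces := tsum_lintegral_gradient_levelPiece_le hu
  have hshift : ∑' j : ℤ, ∫⁻ x, ‖∇ (levelPiece u (j - 2)) x‖ₑ =
      ∑' j : ℤ, ∫⁻ x, ‖∇ (levelPiece u j) x‖ₑ :=
    (Equiv.subRight (2 : ℤ)).tsum_eq fun j => ∫⁻ x, ‖∇ (levelPiece u j) x‖ₑ
  calc _ ≤ ∑' j : ℤ, interpNorm volume (α / finrank ℝ E)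
          ((fun x => ‖x‖ ^ (-(finrank ℝ E - α))) ⋆ ∇ (levelPiece u j)) :=
        interpNorm_norm_rpow_neg_convolution_le_tsum (sub_pos.2 hαn) (sub_lt_self _ hα₀)
          (fun j => (continuous_gradient (contDiff_levelPiece hu j)).aestronglyMeasurable)
          (ne_top_of_le_ne_top hint.2.ne hpieces) (hasSum_gradient_levelPiece hu)
    _ ≤ ∑' j : ℤ, C * ((∫⁻ x, ‖∇ (levelPiece u j) x‖ₑ) +
          ∫⁻ x, ‖∇ (levelPiece u (j - 2)) x‖ₑ) :=
        ENNReal.tsum_le_tsum fun j => hC u j hu hu₀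
    _ = C * (2 * ∑' j : ℤ, ∫⁻ x, ‖∇ (levelPiece u j) x‖ₑ) := by
        rw [ENNReal.tsum_mul_left, ENNReal.tsum_add, hshift, two_mul]
    _ ≤ (C * 2 : ℝ≥0) * ∫⁻ x, ‖∇ u x‖ₑ := by
        push_cast
        rw [mul_assoc]
        gcongr

end GradientEstimate

/-! ### Curl-free fields as limits of gradients -/

section ApproximateIdentity

variable {E : Type*} [NormedAddCommGroup E] [InnerProductSpace ℝ E] [FiniteDimensional ℝ E]
  [MeasurableSpace E] [BorelSpace E] {V : Type*} [NormedAddCommGroup V]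

theorem tendsto_lintegral_enorm_comp_sub_sub {G : E → V} (hG : Integrable G) :
    Tendsto (fun z => ∫⁻ x, ‖G (x - z) - G x‖ₑ) (𝓝 0) (𝓝 0) := by
  have hG₁ : MemLp G 1 := memLp_one_iff_integrable.2 hG
  let shift : C(E, C(E, E)) := (ContinuousMap.mk (fun a : E × E => a.2 - a.1) (by fun_prop)).curry
  have hshift : ∀ z, MeasurePreserving (shift z) := measurePreserving_sub_right volume
  have hcont := (continuous_const (y := hG₁.toLp G)).compMeasurePreservingLp shift.continuous
    hshift ENNReal.one_ne_top
  have hlim := (hcont.edist (continuous_const (y := hG₁.toLp G))).tendsto 0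
  have hnorm : ∀ z, eLpNorm (G ∘ shift z - G) 1 = ∫⁻ x, ‖G (x - z) - G x‖ₑ := fun z =>
    eLpNorm_one_eq_lintegral_enorm
  simp only [Lp.toLp_compMeasurePreserving, Lp.edist_toLp_toLp, hnorm] at hlim
  simpa using hlim

variable [NormedSpace ℝ V] [CompleteSpace V]

theorem lintegral_enorm_convolution_sub_le {K : E → ℝ} {F : E → V} {η : ℝ≥0∞}
    (hK : Integrable K) (hF : Integrable F)
    (hη : ∀ z, K z ≠ 0 → ∫⁻ x, ‖F (x - z) - F x‖ₑ ≤ η) :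
    ∫⁻ x, ‖(K ⋆ F) x - (∫ z, K z) • F x‖ₑ ≤ η * ∫⁻ z, ‖K z‖ₑ := by
  have hmeas : AEStronglyMeasurable (fun p : E × E => K p.2 • (F (p.1 - p.2) - F p.1))
      (volume.prod volume) := by
    simp_rw [smul_sub]
    exact (hK.1.convolution_integrand (ContinuousLinearMap.lsmul ℝ ℝ) hF.1).sub
      (hK.1.comp_snd.smul hF.1.comp_fst)
  calc ∫⁻ x, ‖(K ⋆ F) x - (∫ z, K z) • F x‖ₑ
      ≤ ∫⁻ x, ∫⁻ z, ‖K z • (F (x - z) - F x)‖ₑ := by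
        refine lintegral_mono_ae ?_
        filter_upwards [hK.ae_convolution_exists (ContinuousLinearMap.lsmul ℝ ℝ) hF] with x hx
        have heq : (K ⋆ F) x - (∫ z, K z) • F x = ∫ z, K z • (F (x - z) - F x) := by
          simp_rw [smul_sub]
          exact (congrArg _ (integral_smul_const K (F x)).symm).trans
            (integral_sub hx (hK.smul_const _)).symm
        rw [heq]
        exact enorm_integral_le_lintegral_enorm _
    _ = ∫⁻ z, ∫⁻ x, ‖K z • (F (x - z) - F x)‖ₑ := lintegral_lintegral_swap hmeas.enorm
    _ ≤ ∫⁻ z, η * ‖K z‖ₑ := by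
        refine lintegral_mono fun z => ?_
        simp_rw [enorm_smul]
        rw [lintegral_const_mul' _ _ enorm_ne_top, mul_comm]
        rcases eq_or_ne (K z) 0 with hz | hz
        · simp [hz]
        · gcongr
          exact hη z hz
    _ = _ := lintegral_const_mul'' _ hK.1.enorm

theorem tendsto_lintegral_enorm_rescale_convolution_sub {P : E → ℝ} {F : E → V}
    (hP : Continuous P) (hcP : HasCompactSupport P) (hF : Integrable F) :
    Tendsto (fun s => ∫⁻ x, ‖(rescale (finrank ℝ E) P s ⋆ F) x - (∫ z, P z) • F x‖ₑ)
      (𝓝[>] 0) (𝓝 0) := by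
  refine ENNReal.tendsto_nhds_zero.2 fun ε hε => ?_
  obtain ⟨η, hη, hηε⟩ := ENNReal.exists_nnreal_pos_mul_lt
    (hP.integrable_of_hasCompactSupport hcP (μ := volume)).2.ne hε.ne'
  obtain ⟨r, hr, hball⟩ := Metric.eventually_nhds_iff.1
    ((tendsto_lintegral_enorm_comp_sub_sub hF).eventually (gt_mem_nhds (ENNReal.coe_pos.2 hη)))
  obtain ⟨R, hR, hsupp⟩ := hcP.isBounded.exists_pos_norm_le
  filter_upwards [Ioo_mem_nhdsGT (div_pos hr hR)] with s hs
  have hsmall : ∀ z, rescale (finrank ℝ E) P s z ≠ 0 → ‖z‖ < r := by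
    intro z hz
    have hle := hsupp _ (subset_tsupport P (right_ne_zero_of_mul hz))
    rw [norm_smul, norm_inv, Real.norm_of_nonneg hs.1.le, inv_mul_le_iff₀ hs.1] at hle
    exact hle.trans_lt ((lt_div_iff₀ hR).1 hs.2)
  have hint : ∫ z, rescale (finrank ℝ E) P s z = ∫ z, P z := by
    rw [integral_rescale volume _ _ hs.1, sub_self, Real.rpow_zero, one_mul]
  have hnorm : ∫⁻ z, ‖rescale (finrank ℝ E) P s z‖ₑ = ∫⁻ z, ‖P z‖ₑ := by
    rw [lintegral_enorm_rescale volume _ _ hs.1, sub_self, Real.rpow_zero, ENNReal.ofReal_one,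
      one_mul]
  have hle := lintegral_enorm_convolution_sub_le (η := η)
    ((continuous_rescale hP).integrable_of_hasCompactSupport
      (hasCompactSupport_rescale hcP hs.1.ne')) hF
    fun z hz => (hball (by simpa using hsmall z hz)).le
  rw [hint, hnorm] at hle
  exact hle.trans hηε.le

end ApproximateIdentity

section BoundedConvolution

theorem fderiv_smul_comp_mul {E : Type*} [NormedAddCommGroup E] [NormedSpace ℝ E] {χ φ : E → ℝ}
    (hχ : Differentiable ℝ χ) (hφ : Differentiable ℝ φ)
    (s : ℝ) (x w : E) : fderiv ℝ (fun y => χ (s • y) * φ y) x w =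
      χ (s • x) * fderiv ℝ φ x w + φ x * (s * fderiv ℝ χ (s • x) w) := by
  have hχs : HasFDerivAt (fun y => χ (s • y)) (s • fderiv ℝ χ (s • x)) x := by
    rw [← fderiv_comp_smul]
    exact (hχ.comp (differentiable_id.const_smul s) x).hasFDerivAt
  rw [(hχs.fun_mul (hφ x).hasFDerivAt).fderiv]
  simp

variable {E : Type*} [NormedAddCommGroup E] [InnerProductSpace ℝ E] [FiniteDimensional ℝ E]
  [MeasurableSpace E] [BorelSpace E] {f Q : E → ℝ} {C C' : ℝ}

theorem integrable_convolution_integrand_of_bounded {V : Type*} [NormedAddCommGroup V]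
    [NormedSpace ℝ V] {G : E → V} (hf : Integrable f) (hG : Continuous G)
    (hC : ∀ x, ‖G x‖ ≤ C) (x : E) : Integrable fun y => f y • G (x - y) :=
  hf.smul_bdd C (hG.comp (continuous_sub_left x)).aestronglyMeasurable
    (Eventually.of_forall fun _ => hC _)

theorem tendsto_convolution_cocompact (hf : Integrable f) (hQ : Continuous Q)
    (hC : ∀ x, ‖Q x‖ ≤ C) (hlim : Tendsto Q (cocompact E) (𝓝 0)) :
    Tendsto (f ⋆ Q) (cocompact E) (𝓝 0) := by
  have : (cocompact E).IsCountablyGenerated := by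
    rw [← Metric.cobounded_eq_cocompact, ← comap_norm_atTop]
    infer_instance
  have : Tendsto (f ⋆ Q) (cocompact E) (𝓝 (∫ y, f y • (0 : ℝ))) := by
    refine tendsto_integral_filter_of_dominated_convergence (fun y => ‖f y‖ * C)
      (Eventually.of_forall fun x =>
        (integrable_convolution_integrand_of_bounded hf hQ hC x).1)
      (Eventually.of_forall fun x => Eventually.of_forall fun y => ?_) (hf.norm.mul_const C)
      (Eventually.of_forall fun y => ?_)
    · rw [ContinuousLinearMap.lsmul_apply, norm_smul]
      gcongr
      exact hC _
    · exact (hlim.comp (Homeomorph.subRight y).isClosedEmbedding.tendsto_cocompact).const_smul _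
  simpa using this

theorem hasFDerivAt_convolution_of_bounded (hf : Integrable f) (hQ : ContDiff ℝ 1 Q)
    (hC : ∀ x, ‖Q x‖ ≤ C) (hC' : ∀ x, ‖fderiv ℝ Q x‖ ≤ C') (x : E) :
    HasFDerivAt (f ⋆ Q) (∫ y, f y • fderiv ℝ Q (x - y)) x := by
  refine hasFDerivAt_integral_of_dominated_of_fderiv_le (s := univ)
    (F' := fun x y => f y • fderiv ℝ Q (x - y)) (bound := fun y => ‖f y‖ * C') univ_mem
    (Eventually.of_forall fun z =>
      (integrable_convolution_integrand_of_bounded hf hQ.continuous hC z).1)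
    (integrable_convolution_integrand_of_bounded hf hQ.continuous hC x)
    (integrable_convolution_integrand_of_bounded hf (hQ.continuous_fderiv one_ne_zero) hC' x).1
    (Eventually.of_forall fun y z _ => ?_) (hf.norm.mul_const C')
    (Eventually.of_forall fun y z _ => ?_)
  · rw [norm_smul]
    gcongr
    exact hC' _
  · exact ((hQ.differentiable one_ne_zero (z - y)).hasFDerivAt.comp z
      (hasFDerivAt_sub_const y)).const_smul (f y)

theorem tendsto_integral_mul_fderiv_smul_comp_mul {χ φ : E → ℝ} (hf : Integrable f)
    (hχ : ContDiff ℝ 1 χ) (hcχ : HasCompactSupport χ) (hχ₀ : χ 0 = 1) (hφ : ContDiff ℝ 1 φ)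
    (hC : ∀ x, ‖φ x‖ ≤ C) (hC' : ∀ x, ‖fderiv ℝ φ x‖ ≤ C') (w : E) :
    Tendsto (fun s : ℝ => ∫ x, f x * fderiv ℝ (fun y => χ (s • y) * φ y) x w) (𝓝 0)
      (𝓝 (∫ x, f x * fderiv ℝ φ x w)) := by
  obtain ⟨c, hc⟩ := hcχ.exists_bound_of_continuous hχ.continuous
  obtain ⟨c', hc'⟩ := (hcχ.fderiv ℝ).exists_bound_of_continuous (hχ.continuous_fderiv one_ne_zero)
  have := (hχ.continuous_fderiv one_ne_zero).clm_apply (continuous_const (y := w))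
  have := (hφ.continuous_fderiv one_ne_zero).clm_apply (continuous_const (y := w))
  have hχcont := hχ.continuous
  have hφcont := hφ.continuous
  simp only [fderiv_smul_comp_mul (hχ.differentiable one_ne_zero) (hφ.differentiable one_ne_zero)]
  refine tendsto_integral_filter_of_dominated_convergence
    (fun x => ‖f x‖ * (c * (C' * ‖w‖) + C * (1 * (c' * ‖w‖))))
    (Eventually.of_forall fun s => hf.1.mul (Continuous.aestronglyMeasurable (by fun_prop)))
    ?_ (hf.norm.mul_const _) (Eventually.of_forall fun x => ?_)
  · filter_upwards [Metric.closedBall_mem_nhds (0 : ℝ) one_pos] with s hs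
    refine Eventually.of_forall fun x => ?_
    have hs₁ : ‖s‖ ≤ 1 := by simpa using hs
    have hχle := (fderiv ℝ χ (s • x)).le_of_opNorm_le (hc' _) w
    have hφle := (fderiv ℝ φ x).le_of_opNorm_le (hC' _) w
    have hc₀ := (norm_nonneg _).trans (hc 0)
    have hC₀ := (norm_nonneg _).trans (hC 0)
    rw [norm_mul]
    gcongr
    refine (norm_add_le _ _).trans ?_
    rw [norm_mul, norm_mul, norm_mul]
    gcongr
    exacts [hc _, hC _]
  · have hcont : Continuous fun s : ℝ =>
        f x * (χ (s • x) * fderiv ℝ φ x w + φ x * (s * fderiv ℝ χ (s • x) w)) := by fun_prop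
    simpa [hχ₀] using hcont.tendsto 0

end BoundedConvolution

section CurlFree

variable {d : ℕ} {F : EuclideanSpace ℝ (Fin d) → EuclideanSpace ℝ (Fin d)}

theorem integrable_component (hF : Integrable F) (i : Fin d) : Integrable fun x => F x i :=
  (EuclideanSpace.proj i : EuclideanSpace ℝ (Fin d) →L[ℝ] ℝ).integrable_comp hF

theorem gradient_apply (u : EuclideanSpace ℝ (Fin d) → ℝ) (x : EuclideanSpace ℝ (Fin d))
    (k : Fin d) : ∇ u x k = fderiv ℝ u x (EuclideanSpace.single k 1) := by
  rw [← inner_gradient_left, EuclideanSpace.inner_single_right]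
  simp

theorem CurlFree.const_smul (hcurl : CurlFree F) (c : ℝ) : CurlFree (c • F) := by
  intro i j φ hφ hcφ
  simp only [Pi.smul_apply, PiLp.smul_apply, smul_eq_mul, mul_assoc, integral_const_mul]
  rw [hcurl i j φ hφ hcφ]

theorem CurlFree.integral_mul_fderiv_comm (hF : Integrable F) (hcurl : CurlFree F)
    {φ : EuclideanSpace ℝ (Fin d) → ℝ} {C C' : ℝ} (hφ : ContDiff ℝ ∞ φ) (hC : ∀ x, ‖φ x‖ ≤ C)
    (hC' : ∀ x, ‖fderiv ℝ φ x‖ ≤ C') (i j : Fin d) :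
    ∫ x, F x i * fderiv ℝ φ x (EuclideanSpace.single j 1) =
      ∫ x, F x j * fderiv ℝ φ x (EuclideanSpace.single i 1) := by
  let χ : ContDiffBump (0 : EuclideanSpace ℝ (Fin d)) := ⟨1, 2, one_pos, one_lt_two⟩
  have hχ₀ : χ 0 = 1 := χ.one_of_mem_closedBall (Metric.mem_closedBall_self zero_le_one)
  have hlim (k l : Fin d) := (tendsto_integral_mul_fderiv_smul_comp_mul
    (integrable_component hF k) χ.contDiff χ.hasCompactSupport hχ₀ (hφ.of_le (by simp)) hC hC'
    (EuclideanSpace.single l 1)).mono_left (nhdsWithin_le_nhds (s := {0}ᶜ))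
  refine tendsto_nhds_unique_of_eventuallyEq (hlim i j) (hlim j i) ?_
  filter_upwards [self_mem_nhdsWithin] with s hs
  exact hcurl i j _ ((χ.contDiff.comp (contDiff_const_smul s)).mul hφ)
    ((χ.hasCompactSupport.comp_smul hs).mul_right)

theorem CurlFree.integral_mul_fderiv_sub_comm (hF : Integrable F) (hcurl : CurlFree F)
    {Q : EuclideanSpace ℝ (Fin d) → ℝ} {C C' : ℝ} (hQ : ContDiff ℝ ∞ Q) (hC : ∀ x, ‖Q x‖ ≤ C)
    (hC' : ∀ x, ‖fderiv ℝ Q x‖ ≤ C') (x : EuclideanSpace ℝ (Fin d)) (i j : Fin d) :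
    ∫ y, F y i * fderiv ℝ Q (x - y) (EuclideanSpace.single j 1) =
      ∫ y, F y j * fderiv ℝ Q (x - y) (EuclideanSpace.single i 1) := by
  have hfderiv y : fderiv ℝ (fun y => Q (x - y)) y = -fderiv ℝ Q (x - y) :=
    (((hQ.differentiable (by simp) (x - y)).hasFDerivAt.comp y
      ((hasFDerivAt_id y).const_sub x)).congr_fderiv (by ext; simp)).fderiv
  have h := hcurl.integral_mul_fderiv_comm (φ := fun y => Q (x - y)) hF
    (hQ.comp (contDiff_const.sub contDiff_id)) (fun y => hC _)
    (fun y => by rw [hfderiv, norm_neg]; exact hC' _) i j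
  simpa [hfderiv, integral_neg] using h

theorem CurlFree.hasGradientAt_sum_convolution (hF : Integrable F) (hcurl : CurlFree F)
    {Q : Fin d → EuclideanSpace ℝ (Fin d) → ℝ} {P : EuclideanSpace ℝ (Fin d) → ℝ} {C C' : ℝ}
    (hQ : ∀ i, ContDiff ℝ ∞ (Q i)) (hC : ∀ i x, ‖Q i x‖ ≤ C)
    (hC' : ∀ i x, ‖fderiv ℝ (Q i) x‖ ≤ C')
    (hdiv : ∀ x, ∑ i, fderiv ℝ (Q i) x (EuclideanSpace.single i 1) = P x)
    (hP : Continuous P) (hcP : HasCompactSupport P) (x : EuclideanSpace ℝ (Fin d)) :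
    HasGradientAt (fun x => ∑ i, ((fun y => F y i) ⋆ Q i) x) ((P ⋆ F) x) x := by
  have hQ₁ i : ContDiff ℝ 1 (Q i) := (hQ i).of_le (by simp)
  have hu := HasFDerivAt.fun_sum fun i (_ : i ∈ Finset.univ) => hasFDerivAt_convolution_of_bounded
    (integrable_component hF i) (hQ₁ i) (hC i) (hC' i) x
  have hint i := integrable_convolution_integrand_of_bounded (integrable_component hF i)
    ((hQ₁ i).continuous_fderiv one_ne_zero) (hC' i) x
  have hint' (i k : Fin d) :
      Integrable fun y => F y k * fderiv ℝ (Q i) (x - y) (EuclideanSpace.single i 1) :=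
    (integrable_convolution_integrand_of_bounded (integrable_component hF k)
      ((hQ₁ i).continuous_fderiv one_ne_zero) (hC' i) x).apply_continuousLinearMap _
  convert hu.differentiableAt.hasGradientAt using 1
  ext k
  have hPF : (P ⋆ F) x k = ∫ y, P (x - y) * F y k := by
    have hex := (hcP.convolutionExists_left (ContinuousLinearMap.lsmul ℝ ℝ) hP hF.locallyIntegrable
      x).integrable_swap
    rw [convolution_eq_swap]
    exact ((EuclideanSpace.proj k : EuclideanSpace ℝ (Fin d) →L[ℝ] ℝ).integral_comp_comm hex).symm
  calc (P ⋆ F) x k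
      = ∫ y, ∑ i, F y k * fderiv ℝ (Q i) (x - y) (EuclideanSpace.single i 1) := by
        simp only [hPF, ← hdiv, ← Finset.mul_sum, mul_comm]
    _ = ∑ i, ∫ y, F y i * fderiv ℝ (Q i) (x - y) (EuclideanSpace.single k 1) := by
        rw [integral_finsetSum _ fun i _ => hint' i k]
        exact Finset.sum_congr rfl fun i _ =>
          hcurl.integral_mul_fderiv_sub_comm hF (hQ i) (hC i) (hC' i) x k i
    _ = ∇ (fun x => ∑ i, ((fun y => F y i) ⋆ Q i) x) x k := by
        simp only [gradient_apply, hu.fderiv, sum_apply,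
          ContinuousLinearMap.integral_apply (hint _), smul_apply, smul_eq_mul]

theorem CurlFree.exists_gradient_eq_convolution (hF : Integrable F) (hcurl : CurlFree F)
    {Q : Fin d → EuclideanSpace ℝ (Fin d) → ℝ} {P : EuclideanSpace ℝ (Fin d) → ℝ} {C C' : ℝ}
    (hQ : ∀ i, ContDiff ℝ ∞ (Q i)) (hC : ∀ i x, ‖Q i x‖ ≤ C)
    (hC' : ∀ i x, ‖fderiv ℝ (Q i) x‖ ≤ C') (hQ₀ : ∀ i, Tendsto (Q i) (cocompact _) (𝓝 0))
    (hdiv : ∀ x, ∑ i, fderiv ℝ (Q i) x (EuclideanSpace.single i 1) = P x)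
    (hP : Continuous P) (hcP : HasCompactSupport P) :
    ∃ u : EuclideanSpace ℝ (Fin d) → ℝ, ContDiff ℝ 1 u ∧ Tendsto u (cocompact _) (𝓝 0) ∧
      ∇ u = P ⋆ F := by
  have hgrad := hcurl.hasGradientAt_sum_convolution hF hQ hC hC' hdiv hP hcP
  refine ⟨_, contDiff_one_iff_hasFDerivAt.2 ⟨_, ?_, fun x => (hgrad x).hasFDerivAt⟩, ?_,
    funext fun x => (hgrad x).gradient⟩
  · exact (InnerProductSpace.toDual ℝ _).continuous.comp
      (hcP.continuous_convolution_left _ hP hF.locallyIntegrable)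
  · simpa using tendsto_finsetSum Finset.univ fun i _ => tendsto_convolution_cocompact
      (integrable_component hF i) (hQ i).continuous (hC i) (hQ₀ i)

end CurlFree

section RadialCutoff

variable {E : Type*} [NormedAddCommGroup E] [InnerProductSpace ℝ E]

theorem fderiv_dyadicCutoff_eq_zero {x : E} (hx : ‖x‖ ≤ 1) :
    fderiv ℝ (dyadicCutoff : E → ℝ) x = 0 :=
  IsLocalMin.fderiv_eq_zero <| Eventually.of_forall fun y => by
    rw [dyadicCutoff_eq_zero hx]
    exact dyadicCutoff_nonneg y

theorem hasCompactSupport_fderiv_dyadicCutoff [FiniteDimensional ℝ E] :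
    HasCompactSupport (fderiv ℝ (dyadicCutoff : E → ℝ)) :=
  HasCompactSupport.intro (isCompact_closedBall 0 2) fun x hx =>
    IsLocalMax.fderiv_eq_zero <| Eventually.of_forall fun y => by
      rw [dyadicCutoff_eq_one (x := x) (by simpa using (not_le.1 (by simpa using hx)).le)]
      exact dyadicCutoff_le_one y

theorem hasFDerivAt_dyadicCutoff (x : E) :
    HasFDerivAt dyadicCutoff (fderiv ℝ (dyadicCutoff : E → ℝ) x) x :=
  (contDiff_dyadicCutoff.differentiable (by simp) x).hasFDerivAt

theorem contDiff_fderiv_dyadicCutoff_self :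
    ContDiff ℝ ∞ fun x : E => fderiv ℝ (dyadicCutoff : E → ℝ) x x :=
  (contDiff_dyadicCutoff.fderiv_right (by simp)).clm_apply contDiff_id

theorem fderiv_dyadicCutoff_self_nonneg (x : E) :
    0 ≤ fderiv ℝ (dyadicCutoff : E → ℝ) x x := by
  have hmono : Monotone fun t : ℝ => dyadicCutoff (Real.exp t • x) := fun s t hst =>
    dyadicCutoff_mono (by simp only [norm_smul, Real.norm_eq_abs, Real.abs_exp]; gcongr)
  have hray : HasDerivAt (fun t : ℝ => Real.exp t • x) x 0 := by
    simpa using (Real.hasDerivAt_exp 0).smul_const x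
  have hderiv : HasDerivAt (fun t : ℝ => dyadicCutoff (Real.exp t • x))
      (fderiv ℝ (dyadicCutoff : E → ℝ) x x) 0 :=
    HasFDerivAt.comp_hasDerivAt (l := dyadicCutoff) 0
      (by simpa using hasFDerivAt_dyadicCutoff x) hray
  exact hderiv.deriv ▸ hmono.deriv_nonneg

theorem exists_fderiv_dyadicCutoff_self_pos [Nontrivial E] :
    ∃ x : E, x ≠ 0 ∧ 0 < fderiv ℝ (dyadicCutoff : E → ℝ) x x := by
  obtain ⟨e, he⟩ := exists_norm_eq E zero_le_one
  have hderiv (t : ℝ) : HasDerivAt (fun t : ℝ => dyadicCutoff (t • e))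
      (fderiv ℝ (dyadicCutoff : E → ℝ) (t • e) e) t := by
    have hray : HasDerivAt (fun t : ℝ => t • e) e t := by
      simpa using (hasDerivAt_id t).smul_const e
    exact (hasFDerivAt_dyadicCutoff (t • e)).comp_hasDerivAt t hray
  obtain ⟨t, ht, hslope⟩ := exists_hasDerivAt_eq_slope _ _ (zero_lt_two (α := ℝ))
    (fun t _ => (hderiv t).continuousAt.continuousWithinAt) fun t _ => hderiv t
  have hzero : dyadicCutoff ((0 : ℝ) • e) = 0 := dyadicCutoff_eq_zero (by simp)
  have hone : dyadicCutoff ((2 : ℝ) • e) = 1 := dyadicCutoff_eq_one (by simp [norm_smul, he])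
  refine ⟨t • e, smul_ne_zero ht.1.ne' (norm_ne_zero_iff.1 (by simp [he])), ?_⟩
  rw [map_smul, hslope, hzero, hone]
  exact smul_pos ht.1 (by norm_num)

end RadialCutoff

section TruncatedPower

variable {E : Type*} [NormedAddCommGroup E] {p : ℝ}

/-- The power `‖x‖ ^ p`, cut off smoothly near the origin. -/
noncomputable def truncatedPower (p : ℝ) (x : E) : ℝ := ‖x‖ ^ p * dyadicCutoff x

theorem truncatedPower_eq_zero {x : E} (hx : ‖x‖ ≤ 1) : truncatedPower p x = 0 := by
  rw [truncatedPower, dyadicCutoff_eq_zero hx, mul_zero]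

theorem norm_truncatedPower_le (p : ℝ) (x : E) : ‖truncatedPower p x‖ ≤ ‖x‖ ^ p := by
  rw [truncatedPower, Real.norm_of_nonneg (mul_nonneg (by positivity) (dyadicCutoff_nonneg x))]
  exact mul_le_of_le_one_right (by positivity) (dyadicCutoff_le_one x)

variable [InnerProductSpace ℝ E]

theorem contDiff_truncatedPower : ContDiff ℝ ∞ (truncatedPower p : E → ℝ) :=
  contDiff_norm_rpow_mul contDiff_dyadicCutoff (fun _ => dyadicCutoff_eq_zero) p

theorem fderiv_truncatedPower {x : E} (hx : x ≠ 0) (p : ℝ) :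
    fderiv ℝ (truncatedPower p) x = ‖x‖ ^ p • fderiv ℝ dyadicCutoff x +
      (dyadicCutoff x * (p * ‖x‖ ^ (p - 1))) • fderiv ℝ (fun y => ‖y‖) x := by
  have hnorm := ((contDiffAt_norm ℝ hx).differentiableAt one_ne_zero).hasFDerivAt
  rw [← smul_smul]
  exact ((hnorm.rpow_const (Or.inl (norm_ne_zero_iff.2 hx))).mul
    (hasFDerivAt_dyadicCutoff x)).fderiv

theorem fderiv_truncatedPower_eq_zero {x : E} (hx : ‖x‖ ≤ 1) :
    fderiv ℝ (truncatedPower p) x = 0 :=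
  IsLocalMin.fderiv_eq_zero <| Eventually.of_forall fun y => by
    rw [truncatedPower_eq_zero hx]
    exact mul_nonneg (by positivity) (dyadicCutoff_nonneg y)

theorem fderiv_truncatedPower_self (p : ℝ) (x : E) :
    fderiv ℝ (truncatedPower p) x x =
      ‖x‖ ^ p * fderiv ℝ dyadicCutoff x x + p * truncatedPower p x := by
  rcases eq_or_ne x 0 with rfl | hx
  · simp [truncatedPower_eq_zero]
  have hnorm := (contDiffAt_norm ℝ hx).differentiableAt one_ne_zero
  have hpow : ‖x‖ ^ (p - 1) * ‖x‖ = ‖x‖ ^ p := by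
    rw [← Real.rpow_add_one (norm_ne_zero_iff.2 hx), sub_add_cancel]
  rw [fderiv_truncatedPower hx, add_apply, smul_apply, smul_apply, hnorm.fderiv_norm_self,
    truncatedPower, ← hpow, smul_eq_mul, smul_eq_mul]
  ring

theorem norm_fderiv_truncatedPower_mul_norm_le {C : ℝ} (hp : p ≤ -1)
    (hC : ∀ x, ‖fderiv ℝ (dyadicCutoff : E → ℝ) x‖ ≤ C) (x : E) :
    ‖fderiv ℝ (truncatedPower p) x‖ * ‖x‖ ≤ C + |p| := by
  have hC₀ := (norm_nonneg _).trans (hC 0)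
  rcases le_total ‖x‖ 1 with hx | hx
  · rw [fderiv_truncatedPower_eq_zero hx, norm_zero, zero_mul]
    positivity
  have hx₀ : 0 < ‖x‖ := zero_lt_one.trans_le hx
  have hpow (r : ℝ) (hr : r ≤ 0) : ‖x‖ ^ r ≤ 1 := Real.rpow_le_one_of_one_le_of_nonpos hx hr
  have hlip := norm_fderiv_le_of_lipschitz ℝ (lipschitzWith_one_norm (E := E)) (x₀ := x)
  have hcut : ‖dyadicCutoff x‖ ≤ 1 := by
    simpa [abs_of_nonneg (dyadicCutoff_nonneg x)] using dyadicCutoff_le_one x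
  calc ‖fderiv ℝ (truncatedPower p) x‖ * ‖x‖
      ≤ (‖x‖ ^ p * C + 1 * (|p| * ‖x‖ ^ (p - 1)) * 1) * ‖x‖ := by
        rw [fderiv_truncatedPower (norm_pos_iff.1 hx₀)]
        gcongr
        refine (norm_add_le _ _).trans ?_
        rw [norm_smul, norm_smul, norm_mul, norm_mul, Real.norm_of_nonneg (by positivity),
          Real.norm_of_nonneg (r := ‖x‖ ^ (p - 1)) (by positivity), Real.norm_eq_abs p]
        gcongr
        exacts [hC x, by simpa using hlip]
    _ = ‖x‖ ^ (p + 1) * C + |p| * ‖x‖ ^ p := by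
        rw [Real.rpow_add_one hx₀.ne', Real.rpow_sub_one hx₀.ne']
        field_simp
    _ ≤ 1 * C + |p| * 1 := by
        gcongr
        exacts [hpow _ (by linarith), hpow _ (by linarith)]
    _ = C + |p| := by ring

theorem norm_truncatedPower_mul_le (p : ℝ) {ℓ : E →L[ℝ] ℝ} (hℓ : ‖ℓ‖ ≤ 1) (x : E) :
    ‖truncatedPower p x * ℓ x‖ ≤ ‖x‖ ^ (p + 1) := by
  rcases eq_or_ne x 0 with rfl | hx
  · rw [map_zero, mul_zero, norm_zero]
    positivity
  rw [norm_mul, Real.rpow_add_one (norm_ne_zero_iff.2 hx)]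
  gcongr
  exacts [norm_truncatedPower_le p x, by simpa using ℓ.le_of_opNorm_le hℓ x]

theorem norm_truncatedPower_mul_le_one (hp : p ≤ -1) {ℓ : E →L[ℝ] ℝ} (hℓ : ‖ℓ‖ ≤ 1) (x : E) :
    ‖truncatedPower p x * ℓ x‖ ≤ 1 := by
  rcases le_total ‖x‖ 1 with hx | hx
  · simp [truncatedPower_eq_zero hx]
  · exact (norm_truncatedPower_mul_le p hℓ x).trans
      (Real.rpow_le_one_of_one_le_of_nonpos hx (by linarith))

theorem tendsto_truncatedPower_mul [ProperSpace E] (hp : p < -1) {ℓ : E →L[ℝ] ℝ} (hℓ : ‖ℓ‖ ≤ 1) :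
    Tendsto (fun x => truncatedPower p x * ℓ x) (cocompact E) (𝓝 0) := by
  refine squeeze_zero_norm (norm_truncatedPower_mul_le p hℓ) ?_
  simpa only [neg_neg, Function.comp_def] using
    (tendsto_rpow_neg_atTop (y := -(p + 1)) (by linarith)).comp
      (tendsto_norm_cocompact_atTop (E := E))

theorem fderiv_truncatedPower_mul (p : ℝ) (ℓ : E →L[ℝ] ℝ) (x : E) :
    fderiv ℝ (fun x => truncatedPower p x * ℓ x) x =
      truncatedPower p x • ℓ + ℓ x • fderiv ℝ (truncatedPower p) x :=
  ((contDiff_truncatedPower.differentiable (by simp) x).hasFDerivAt.fun_mul ℓ.hasFDerivAt).fderiv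

theorem exists_norm_fderiv_truncatedPower_mul_le [FiniteDimensional ℝ E] (hp : p ≤ -1) :
    ∃ C, ∀ ℓ : E →L[ℝ] ℝ, ‖ℓ‖ ≤ 1 → ∀ x, ‖fderiv ℝ (fun x => truncatedPower p x * ℓ x) x‖ ≤ C := by
  obtain ⟨C, hC⟩ := hasCompactSupport_fderiv_dyadicCutoff.exists_bound_of_continuous
    (contDiff_dyadicCutoff.continuous_fderiv (E := E) (by simp))
  refine ⟨1 * 1 + (C + |p|), fun ℓ hℓ x => ?_⟩
  have hpow : ‖truncatedPower p x‖ ≤ 1 := by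
    rcases le_total ‖x‖ 1 with hx | hx
    · simp [truncatedPower_eq_zero hx]
    · exact (norm_truncatedPower_le p x).trans
        (Real.rpow_le_one_of_one_le_of_nonpos hx (by linarith))
  calc ‖fderiv ℝ (fun x => truncatedPower p x * ℓ x) x‖
      ≤ ‖truncatedPower p x‖ * ‖ℓ‖ + ‖ℓ x‖ * ‖fderiv ℝ (truncatedPower p) x‖ := by
        rw [fderiv_truncatedPower_mul, ← norm_smul, ← norm_smul]
        exact norm_add_le _ _
    _ ≤ 1 * 1 + ‖fderiv ℝ (truncatedPower p) x‖ * ‖x‖ := by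
        rw [mul_comm ‖ℓ x‖]
        gcongr
        simpa using ℓ.le_of_opNorm_le hℓ x
    _ ≤ 1 * 1 + (C + |p|) := by
        gcongr
        exact norm_fderiv_truncatedPower_mul_norm_le hp hC x

end TruncatedPower

section RadialMollifier

variable {E : Type*} [NormedAddCommGroup E] [InnerProductSpace ℝ E]

/-- The divergence of the smoothly truncated Newtonian field `dyadicCutoff x • x / ‖x‖ ^ n`, where
`n` is the dimension; up to normalization it is a mollifier. -/
noncomputable def radialMollifier (x : E) : ℝ :=
  ‖x‖ ^ (-(finrank ℝ E : ℝ)) * fderiv ℝ dyadicCutoff x x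

theorem continuous_radialMollifier : Continuous (radialMollifier : E → ℝ) :=
  (contDiff_norm_rpow_mul contDiff_fderiv_dyadicCutoff_self
    (fun x hx => by rw [fderiv_dyadicCutoff_eq_zero hx, zero_apply]) _).continuous

theorem hasCompactSupport_radialMollifier [FiniteDimensional ℝ E] :
    HasCompactSupport (radialMollifier : E → ℝ) :=
  hasCompactSupport_fderiv_dyadicCutoff.mono' fun x hx => subset_closure fun h =>
    hx (by simp [radialMollifier, h])

theorem integral_radialMollifier_pos [FiniteDimensional ℝ E] [MeasurableSpace E] [BorelSpace E]
    [Nontrivial E] : 0 < ∫ x : E, radialMollifier x := by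
  obtain ⟨x, hx, hpos⟩ := exists_fderiv_dyadicCutoff_self_pos (E := E)
  have := norm_pos_iff.2 hx
  exact continuous_radialMollifier.integral_pos_of_hasCompactSupport_nonneg_nonzero
    hasCompactSupport_radialMollifier
    (fun y => mul_nonneg (by positivity) (fderiv_dyadicCutoff_self_nonneg y))
    (mul_pos (by positivity) hpos).ne'

theorem sum_fderiv_truncatedPower_mul {d : ℕ} (x : EuclideanSpace ℝ (Fin d)) :
    ∑ i, fderiv ℝ (fun x : EuclideanSpace ℝ (Fin d) =>
        truncatedPower (-d) x * EuclideanSpace.proj (𝕜 := ℝ) i x) x (EuclideanSpace.single i 1) =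
      radialMollifier x := by
  have hcoord : ∑ i, x i • EuclideanSpace.single i (1 : ℝ) = x := by
    simpa using (EuclideanSpace.basisFun (Fin d) ℝ).sum_repr x
  have heuler : ∑ i, x i * fderiv ℝ (truncatedPower (-d)) x (EuclideanSpace.single i 1) =
      fderiv ℝ (truncatedPower (-d)) x x := by
    simp only [← smul_eq_mul, ← map_smul, ← map_sum, hcoord]
  calc _ = ∑ i, (truncatedPower (-d) x +
        x i * fderiv ℝ (truncatedPower (-d)) x (EuclideanSpace.single i 1)) :=
        Finset.sum_congr rfl fun i _ => by rw [fderiv_truncatedPower_mul]; simp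
    _ = d * truncatedPower (-d) x + fderiv ℝ (truncatedPower (-d)) x x := by
        simp [Finset.sum_add_distrib, heuler]
    _ = radialMollifier x := by
        rw [fderiv_truncatedPower_self, radialMollifier, finrank_euclideanSpace_fin]
        ring

end RadialMollifier

section GradientApproximation

variable {d : ℕ} {F : EuclideanSpace ℝ (Fin d) → EuclideanSpace ℝ (Fin d)}

theorem CurlFree.exists_gradient_eq_rescale_convolution (hd : 2 ≤ d) (hF : Integrable F)
    (hcurl : CurlFree F) {s : ℝ} (hs : 0 < s) :
    ∃ u : EuclideanSpace ℝ (Fin d) → ℝ, ContDiff ℝ 1 u ∧ Tendsto u (cocompact _) (𝓝 0) ∧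
      ∇ u = rescale d radialMollifier s ⋆ F := by
  have hd' : -(d : ℝ) < -1 := by simpa using (Nat.one_lt_cast (α := ℝ)).2 hd
  have hproj (i : Fin d) : ‖(EuclideanSpace.proj i : EuclideanSpace ℝ (Fin d) →L[ℝ] ℝ)‖ ≤ 1 :=
    ContinuousLinearMap.opNorm_le_bound _ zero_le_one fun x => by
      simpa using PiLp.norm_apply_le x i
  let Q (i : Fin d) (x : EuclideanSpace ℝ (Fin d)) : ℝ :=
    truncatedPower (-d) x * EuclideanSpace.proj (𝕜 := ℝ) i x
  obtain ⟨C, hC⟩ := exists_norm_fderiv_truncatedPower_mul_le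
    (E := EuclideanSpace ℝ (Fin d)) hd'.le
  refine hcurl.exists_gradient_eq_convolution hF (Q := fun i => rescale (d - 1) (Q i) s)
    (C := ‖s ^ (-((d : ℝ) - 1))‖ * 1) (C' := ‖s ^ (-((d : ℝ) - 1) - 1)‖ * C)
    (fun i => contDiff_rescale
      (contDiff_truncatedPower.mul (EuclideanSpace.proj (𝕜 := ℝ) i).contDiff))
    (fun i x => ?_) (fun i x => ?_) (fun i => ?_) (fun x => ?_)
    (continuous_rescale continuous_radialMollifier)
    (hasCompactSupport_rescale hasCompactSupport_radialMollifier hs.ne')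
  · rw [rescale, norm_mul]
    gcongr
    exact norm_truncatedPower_mul_le_one hd'.le (hproj i) _
  · rw [fderiv_rescale _ _ hs, norm_smul]
    gcongr
    exact hC _ (hproj i) _
  · have hdilate : Tendsto (s⁻¹ • · : EuclideanSpace ℝ (Fin d) → _) (cocompact _) (cocompact _) :=
      (Homeomorph.smulOfNeZero s⁻¹ (inv_ne_zero hs.ne')).isClosedEmbedding.tendsto_cocompact
    rw [← mul_zero (s ^ (-((d : ℝ) - 1)))]
    exact ((tendsto_truncatedPower_mul hd' (hproj i)).comp hdilate).const_mul _
  · simp only [fderiv_rescale _ _ hs, smul_apply, ← Finset.smul_sum]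
    rw [sum_fderiv_truncatedPower_mul, rescale, smul_eq_mul]
    congr 2
    ring

theorem CurlFree.exists_lintegral_enorm_sub_gradient_le (hd : 2 ≤ d) (hF : Integrable F)
    (hcurl : CurlFree F) {ε : ℝ≥0∞} (hε : 0 < ε) :
    ∃ u : EuclideanSpace ℝ (Fin d) → ℝ, ContDiff ℝ 1 u ∧ Tendsto u (cocompact _) (𝓝 0) ∧
      Integrable (∇ u) ∧ ∫⁻ x, ‖F x - ∇ u x‖ₑ ≤ ε := by
  have : Nonempty (Fin d) := ⟨⟨0, by lia⟩⟩
  let κ : ℝ := ∫ x : EuclideanSpace ℝ (Fin d), radialMollifier x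
  have hκ : κ ≠ 0 := integral_radialMollifier_pos.ne'
  have hlim := tendsto_lintegral_enorm_rescale_convolution_sub
    (continuous_radialMollifier (E := EuclideanSpace ℝ (Fin d)))
    hasCompactSupport_radialMollifier (hF.smul κ⁻¹)
  obtain ⟨s, hsε, hs⟩ := ((ENNReal.tendsto_nhds_zero.1 hlim ε hε).and self_mem_nhdsWithin).exists
  obtain ⟨u, hu, hu₀, hgrad⟩ := (hcurl.const_smul κ⁻¹).exists_gradient_eq_rescale_convolution hd
    (hF.smul κ⁻¹) hs
  have hF' x : κ • (κ⁻¹ • F) x = F x := smul_inv_smul₀ hκ _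
  have hint : Integrable (∇ u) := by
    rw [hgrad]
    exact ((continuous_rescale continuous_radialMollifier).integrable_of_hasCompactSupport
      (hasCompactSupport_rescale hasCompactSupport_radialMollifier hs.ne')).integrable_convolution
        _ (hF.smul κ⁻¹)
  refine ⟨u, hu, hu₀, hint, le_trans (le_of_eq ?_) hsε⟩
  simp only [hgrad, finrank_euclideanSpace_fin]
  exact lintegral_congr fun x => by rw [enorm_sub_rev, ← hF' x]

end GradientApproximation

/-! ### The Riesz potential of a curl-free field -/

section TelescopingSeries

variable {Ω V : Type*} [MeasurableSpace Ω] [NormedAddCommGroup V] {μ : Measure Ω}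

theorem hasSum_sub_of_tsum_enorm_sub_ne_top [CompleteSpace V] {v : V} {h : ℕ → V} (h₀ : h 0 = 0)
    (hsum : ∑' m, ‖v - h m‖ₑ ≠ ⊤) : HasSum (fun m => h (m + 1) - h m) v := by
  have hsucc : ∑' m, ‖v - h (m + 1)‖ₑ ≠ ⊤ := ne_top_of_le_ne_top hsum
    (ENNReal.tsum_comp_le_tsum_of_injective (add_left_injective 1) fun m => ‖v - h m‖ₑ)
  have hsummable : Summable fun m => h (m + 1) - h m := by
    simpa using (Summable.of_enorm hsum).sub (Summable.of_enorm hsucc)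
  rw [hsummable.hasSum_iff_tendsto_nat]
  simpa [Finset.sum_range_sub h, h₀] using
    (Summable.of_enorm hsum).tendsto_atTop_zero.const_sub v

theorem lintegral_enorm_sub_le_add {F G H : Ω → V} (hG : AEStronglyMeasurable (F - G) μ) :
    ∫⁻ x, ‖H x - G x‖ₑ ∂μ ≤ ∫⁻ x, ‖F x - G x‖ₑ ∂μ + ∫⁻ x, ‖F x - H x‖ₑ ∂μ := by
  rw [← lintegral_add_left' (by simpa using hG.enorm)]
  refine lintegral_mono fun x => ?_
  simpa using enorm_sub_le (a := F x - G x) (b := F x - H x)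

theorem exists_ae_hasSum_of_forall_exists_lintegral_enorm_sub_le [CompleteSpace V] {F : Ω → V}
    {A : AddSubgroup (Ω → V)} (hA : ∀ G ∈ A, Integrable G μ) (hF : Integrable F μ)
    (happrox : ∀ ε > 0, ∃ H ∈ A, ∫⁻ x, ‖F x - H x‖ₑ ∂μ ≤ ε) :
    ∃ G : ℕ → Ω → V, (∀ m, G m ∈ A) ∧ (∀ᵐ x ∂μ, HasSum (fun m => G m x) (F x)) ∧
      ∑' m, ∫⁻ x, ‖G m x‖ₑ ∂μ ≤ 4 * ∫⁻ x, ‖F x‖ₑ ∂μ := by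
  set N := ∫⁻ x, ‖F x‖ₑ ∂μ with hN
  have hgeom (c : ℝ≥0∞) : ∑' m : ℕ, c * 2⁻¹ ^ m = c * 2 := by
    rw [ENNReal.tsum_mul_left, ENNReal.tsum_geometric, ENNReal.one_sub_inv_two, inv_inv]
  have hnear (m : ℕ) : ∃ H ∈ A, ∫⁻ x, ‖F x - H x‖ₑ ∂μ ≤ N * 2⁻¹ ^ m ∧ (m = 0 → H = 0) := by
    by_cases h : m = 0 ∨ N = 0
    · have hzero : ∫⁻ x, ‖F x - (0 : Ω → V) x‖ₑ ∂μ = N := by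
        simp only [Pi.zero_apply, sub_zero, hN]
      refine ⟨0, zero_mem A, hzero.trans_le ?_, fun _ => rfl⟩
      rcases h with h | h <;> simp [h]
    · rw [not_or] at h
      obtain ⟨H, hH, hFH⟩ := happrox (N * 2⁻¹ ^ m)
        (ENNReal.mul_pos h.2 (pow_ne_zero m (ENNReal.inv_ne_zero.2 ENNReal.ofNat_ne_top)))
      exact ⟨H, hH, hFH, fun hm => absurd hm h.1⟩
  choose H hH hFH hH₀ using hnear
  have hmeas (m : ℕ) : AEStronglyMeasurable (F - H m) μ := hF.1.sub (hA _ (hH m)).1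
  have herror : ∫⁻ x, ∑' m, ‖F x - H m x‖ₑ ∂μ ≠ ⊤ := by
    rw [lintegral_tsum fun m => by simpa using (hmeas m).enorm]
    exact ne_top_of_le_ne_top (ENNReal.mul_ne_top hF.2.ne ENNReal.ofNat_ne_top)
      ((ENNReal.tsum_le_tsum hFH).trans_eq (hgeom N))
  refine ⟨fun m => H (m + 1) - H m, fun m => sub_mem (hH _) (hH _), ?_, ?_⟩
  · filter_upwards [ae_lt_top' (AEMeasurable.tsum fun m => by simpa using (hmeas m).enorm) herror]
      with x hx
    exact hasSum_sub_of_tsum_enorm_sub_ne_top (h := fun m => H m x) (congrFun (hH₀ 0 rfl) x) hx.ne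
  · calc ∑' m, ∫⁻ x, ‖H (m + 1) x - H m x‖ₑ ∂μ
        ≤ ∑' m : ℕ, (N * 2⁻¹ ^ m + N * 2⁻¹ ^ m) := ENNReal.tsum_le_tsum fun m =>
          (lintegral_enorm_sub_le_add (hmeas m)).trans (add_le_add (hFH m) ((hFH (m + 1)).trans
            (by gcongr N * ?_; exact pow_le_pow_of_le_one zero_le (by simp) m.le_succ)))
      _ = 4 * N := by rw [ENNReal.tsum_add, hgeom]; ring

end TelescopingSeries

section DecayingGradients

variable (E : Type*) [NormedAddCommGroup E] [InnerProductSpace ℝ E] [FiniteDimensional ℝ E]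
  [MeasurableSpace E] [BorelSpace E]

/-- The group of integrable gradients of `C¹` functions vanishing at infinity, the fields to which
`exists_interpNorm_convolution_gradient_le` applies. -/
def decayingGradients : AddSubgroup (E → E) :=
  AddSubgroup.ofSub {F | ∃ u : E → ℝ, ContDiff ℝ 1 u ∧ Tendsto u (cocompact E) (𝓝 0) ∧
      Integrable (∇ u) ∧ ∇ u = F}
    ⟨0, fun _ => 0, contDiff_const, tendsto_const_nhds, by simp [gradient_fun_const'],
      gradient_fun_const' 0⟩ <| by
    rintro _ ⟨u, hu, hu₀, hintu, rfl⟩ _ ⟨v, hv, hv₀, hintv, rfl⟩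
    have hsub : ∇ (u - v) = ∇ u + -∇ v := by
      ext1 x
      simp only [gradient, Pi.add_apply, Pi.neg_apply, ← sub_eq_add_neg, map_sub,
        fderiv_sub (hu.differentiable one_ne_zero x) (hv.differentiable one_ne_zero x)]
    exact ⟨u - v, hu.sub hv, sub_zero (0 : ℝ) ▸ hu₀.sub hv₀, hsub ▸ hintu.add hintv.neg, hsub⟩

end DecayingGradients

section RieszPotential

variable {d : ℕ} {α : ℝ} {F : EuclideanSpace ℝ (Fin d) → EuclideanSpace ℝ (Fin d)}

theorem exists_interpNorm_convolution_le_of_curlFree (hd : 2 ≤ d) (hα₀ : 0 < α) (hαd : α < d) :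
    ∃ C : ℝ≥0, ∀ F : EuclideanSpace ℝ (Fin d) → EuclideanSpace ℝ (Fin d), Integrable F →
      CurlFree F → interpNorm volume (α / d) ((fun x => ‖x‖ ^ (-(d - α))) ⋆ F) ≤
        C * ∫⁻ x, ‖F x‖ₑ := by
  have hrank : finrank ℝ (EuclideanSpace ℝ (Fin d)) = d := finrank_euclideanSpace_fin
  obtain ⟨C, hC⟩ := exists_interpNorm_convolution_gradient_le
    (E := EuclideanSpace ℝ (Fin d)) (by rw [hrank]; lia) hα₀ (by rwa [hrank])
  rw [hrank] at hC
  refine ⟨C * 4, fun F hF hcurl => ?_⟩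
  obtain ⟨G, hG, hGF, hsum⟩ := exists_ae_hasSum_of_forall_exists_lintegral_enorm_sub_le
    (A := decayingGradients (EuclideanSpace ℝ (Fin d)))
    (by rintro _ ⟨u, -, -, hint, rfl⟩; exact hint) hF fun ε hε => by
      obtain ⟨u, hu, hu₀, hint, hle⟩ := hcurl.exists_lintegral_enorm_sub_gradient_le hd hF hε
      exact ⟨∇ u, ⟨u, hu, hu₀, hint, rfl⟩, hle⟩
  have hbound (m : ℕ) : interpNorm volume (α / d) ((fun x => ‖x‖ ^ (-(d - α))) ⋆ G m) ≤
      C * ∫⁻ x, ‖G m x‖ₑ := by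
    obtain ⟨u, hu, hu₀, hint, heq⟩ := hG m
    exact heq ▸ hC u hu hu₀ hint
  have hmeas (m : ℕ) : AEStronglyMeasurable (G m) := by
    obtain ⟨u, -, -, hint, heq⟩ := hG m
    exact heq ▸ hint.1
  calc interpNorm volume (α / d) ((fun x => ‖x‖ ^ (-(d - α))) ⋆ F)
      ≤ ∑' m, interpNorm volume (α / d) ((fun x => ‖x‖ ^ (-(d - α))) ⋆ G m) :=
        interpNorm_norm_rpow_neg_convolution_le_tsum (sub_pos.2 hαd) (by rw [hrank]; linarith)
          hmeas (ne_top_of_le_ne_top (ENNReal.mul_ne_top ENNReal.ofNat_ne_top hF.2.ne) hsum) hGF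
    _ ≤ ∑' m, C * ∫⁻ x, ‖G m x‖ₑ := ENNReal.tsum_le_tsum hbound
    _ ≤ (C * 4 : ℝ≥0) * ∫⁻ x, ‖F x‖ₑ := by
        rw [ENNReal.tsum_mul_left, ENNReal.coe_mul, mul_assoc]
        gcongr
        exact_mod_cast hsum

theorem ae_integrable_norm_rpow_neg_smul (hα₀ : 0 < α) (hαd : α < d) (hF : Integrable F) :
    ∀ᵐ x, Integrable fun y => ‖x - y‖ ^ (-(d - α)) • F y := by
  filter_upwards [ae_convolutionExistsAt_norm_rpow_neg (sub_pos.2 hαd)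
    (by rw [finrank_euclideanSpace_fin]; linarith) hF] with x hx using hx.integrable_swap

theorem rieszIntegrand_apply (x y : EuclideanSpace ℝ (Fin d)) (i : Fin d) :
    rieszIntegrand α (fun y => F y i) x y =
      EuclideanSpace.proj (𝕜 := ℝ) i (‖x - y‖ ^ (-(d - α)) • F y) := by
  simp [rieszIntegrand, Real.rpow_neg (norm_nonneg _), -neg_sub, div_eq_inv_mul]

theorem integrable_rieszIntegrand {x : EuclideanSpace ℝ (Fin d)}
    (hx : Integrable fun y => ‖x - y‖ ^ (-(d - α)) • F y) (i : Fin d) :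
    Integrable (rieszIntegrand α (fun y => F y i) x) := by
  simpa only [← rieszIntegrand_apply] using
    (EuclideanSpace.proj (𝕜 := ℝ) i).integrable_comp hx

theorem rieszPotentialVec_eq_convolution {x : EuclideanSpace ℝ (Fin d)}
    (hx : Integrable fun y => ‖x - y‖ ^ (-(d - α)) • F y) :
    rieszPotentialVec α F x =
      ((fun x => ‖x‖ ^ (-(d - α))) ⋆ ((rieszConst d α)⁻¹ • F)) x := by
  rw [convolution_smul, Pi.smul_apply, convolution_eq_swap]
  ext i
  have h := (EuclideanSpace.proj (𝕜 := ℝ) i).integral_comp_comm hx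
  simp only [← rieszIntegrand_apply] at h
  simp [rieszPotentialVec, rieszPotential, h]

theorem ae_rieszPotentialVec_eq_convolution (hα₀ : 0 < α) (hαd : α < d) (hF : Integrable F) :
    rieszPotentialVec α F =ᵐ[volume]
      (fun x => ‖x‖ ^ (-(d - α))) ⋆ ((rieszConst d α)⁻¹ • F) :=
  (ae_integrable_norm_rpow_neg_smul hα₀ hαd hF).mono fun _ => rieszPotentialVec_eq_convolution

theorem aestronglyMeasurable_rieszPotentialVec (hα₀ : 0 < α) (hαd : α < d) (hF : Integrable F) :
    AEStronglyMeasurable (rieszPotentialVec α F) :=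
  (aestronglyMeasurable_convolution (measurable_norm.pow_const _).aestronglyMeasurable
    (hF.smul _).1).congr
    (ae_rieszPotentialVec_eq_convolution hα₀ hαd hF).symm

theorem exists_lorentzNorm_rieszPotentialVec_le (hd : 2 ≤ d) (hα₀ : 0 < α) (hαd : α < d) :
    ∃ C : ℝ≥0, ∀ F : EuclideanSpace ℝ (Fin d) → EuclideanSpace ℝ (Fin d), Integrable F →
      CurlFree F → lorentzNorm (d / (d - α)) 1 (rieszPotentialVec α F) ≤ C * ∫⁻ x, ‖F x‖ₑ := by
  obtain ⟨C, hC⟩ := exists_interpNorm_convolution_le_of_curlFree hd hα₀ hαd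
  refine ⟨C * ‖(rieszConst d α)⁻¹‖₊, fun F hF hcurl => ?_⟩
  have hq : 1 / (d / (d - α)) = 1 - α / d := by
    have : (d : ℝ) ≠ 0 := (hα₀.trans hαd).ne'
    field_simp
  calc lorentzNorm (d / (d - α)) 1 (rieszPotentialVec α F)
      ≤ interpNorm volume (α / d) (rieszPotentialVec α F) :=
        lorentzNorm_le_interpNorm (aestronglyMeasurable_rieszPotentialVec hα₀ hαd hF) hq
    _ ≤ interpNorm volume (α / d)
          ((fun x => ‖x‖ ^ (-(d - α))) ⋆ ((rieszConst d α)⁻¹ • F)) :=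
        interpNorm_mono_ae ((ae_rieszPotentialVec_eq_convolution hα₀ hαd hF).mono
          fun x hx => by rw [hx])
    _ ≤ C * ∫⁻ x, ‖((rieszConst d α)⁻¹ • F) x‖ₑ := hC _ (hF.smul _) (hcurl.const_smul _)
    _ = (C * ‖(rieszConst d α)⁻¹‖₊ : ℝ≥0) * ∫⁻ x, ‖F x‖ₑ := by
        simp_rw [Pi.smul_apply, enorm_smul]
        rw [lintegral_const_mul' _ _ enorm_ne_top, ENNReal.coe_mul, mul_assoc, enorm_eq_nnnorm]

end RieszPotential

theorem theorem1p1 (d : ℕ) (hd : 2 ≤ d) (α : ℝ) (hα₀ : 0 < α) (hαd : α < d) :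
    ∃ C : ℝ, 0 < C ∧
      ∀ F : EuclideanSpace ℝ (Fin d) → EuclideanSpace ℝ (Fin d),
        MemLp F 1 volume → CurlFree F →
          (∀ᵐ x : EuclideanSpace ℝ (Fin d), ∀ i : Fin d,
            Integrable (rieszIntegrand α (fun y => F y i) x) volume) ∧
          MemLorentz ((d : ℝ) / (d - α)) 1 (rieszPotentialVec α F) ∧
          lorentzNorm ((d : ℝ) / (d - α)) 1 (rieszPotentialVec α F) ≤
            ENNReal.ofReal C * eLpNorm F 1 volume := by
  obtain ⟨C, hC⟩ := exists_lorentzNorm_rieszPotentialVec_le hd hα₀ hαd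
  refine ⟨C + 1, by positivity, fun F hF hcurl => ?_⟩
  have hint : Integrable F := memLp_one_iff_integrable.1 hF
  have hbound : lorentzNorm (d / (d - α)) 1 (rieszPotentialVec α F) ≤
      ENNReal.ofReal (C + 1) * eLpNorm F 1 volume := by
    rw [eLpNorm_one_eq_lintegral_enorm]
    refine (hC F hint hcurl).trans ?_
    gcongr
    exact ENNReal.ofReal_coe_nnreal.symm.trans_le (ENNReal.ofReal_le_ofReal (by simp))
  exact ⟨(ae_integrable_norm_rpow_neg_smul hα₀ hαd hint).mono fun _ => integrable_rieszIntegrand,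
    ⟨aestronglyMeasurable_rieszPotentialVec hα₀ hαd hint,
      hbound.trans_lt (ENNReal.mul_lt_top ENNReal.ofReal_lt_top hF.2)⟩, hbound⟩
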